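/- Let $\mathbb D$ be the open unit disc of $\mathbb C$, $dA$ Lebesgue area measure, and $\alpha>-1$. The weighted Bergman space $\mathcal A^2_\alpha$ consists of all holomorphic $f:\mathbb D\to\mathbb C$ for which \[ \|f\|_{\mathcal A^2_\alpha}=\Bigl(\frac1\pi\int_{\mathbb D}|f(z)|^2(1-|z|^2)^\alpha\,dA(z)\Bigr)^{1/2} \] is finite. Let $\varphi:\mathbb D\to\mathbb D$ be holomorphic, let $h\in\mathcal A^2_\alpha$, and let $W_{h,\varphi}f=h\cdot(f\circ\varphi)$ be the weighted composition operator. Let $\nu_{h,\varphi}$ be the Borel measure on $\mathbb D$ given by \[ \nu_{h,\varphi}(E)=\int_{\varphi^{-1}(E)}|h(z)|^2(1-|z|^2)^\alpha\,dA(z). \] A Borel measure $\mu$ on $\mathbb D$ is called an $\mathcal A^2_\alpha$-Carleson measure if the canonical embedding $J:\mathcal A^2_\alpha\to L^2(\mathbb D,\mu)$, $f\mapsto f$, is (defined and) bounded, and a vanishing $\mathcal A^2_\alpha$-Carleson measure if $J$ is (defined and) compact. Then the following are equivalent: (i) $W_{h,\varphi}$ maps $\mathcal A^2_\alpha$ into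 itself and is bounded; (ii) $\nu_{h,\varphi}$ is an $\mathcal A^2_\alpha$-Carleson measure; (iii) $\displaystyle\sup_{|w|<1}\left\|\frac{(1-|w|^2)^{1+\alpha/2}\,h}{(1-\overline w\varphi)^{\alpha+2}}\right\|_{\mathcal A^2_\alpha}<\infty$, where the power in the denominator is the principal one. Moreover, $W_{h,\varphi}$ is compact on $\mathcal A^2_\alpha$ if and only if $\nu_{h,\varphi}$ is a vanishing $\mathcal A^2_\alpha$-Carleson measure, and also if and only if \[ \left\|\frac{(1-|w|^2)^{1+\alpha/2}\,h}{(1-\overline w\varphi)^{\alpha+2}}\right\|_{\mathcal A^2_\alpha}\to0\qquad\text{as }|w|\to1. \] -/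

import Mathlib

open MeasureTheory Filter Topology
open scoped ENNReal ComplexConjugate

noncomputable section

/-- The open unit disc of `ℂ`. -/
abbrev Disc : Type := Metric.ball (0 : ℂ) 1

/-- `f` is holomorphic on the open unit disc. -/
def IsHolomorphicOnDisc (f : Disc → ℂ) : Prop :=
  ∃ F : ℂ → ℂ, DifferentiableOn ℂ F (Metric.ball 0 1) ∧ ∀ z : Disc, F z = f z

theorem IsHolomorphicOnDisc.continuous {f : Disc → ℂ} (hf : IsHolomorphicOnDisc f) :
    Continuous f := by
  obtain ⟨F, hF, hFf⟩ := hf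
  have h := continuousOn_iff_continuous_domRestrict.mp hF.continuousOn
  have e : (Metric.ball (0 : ℂ) 1).domRestrict F = f := funext hFf
  rwa [e] at h

/-- Lebesgue area measure `dA` on the disc. -/
def discArea : Measure Disc := (volume : Measure ℂ).comap Subtype.val

/-- The measure `(1 - |z|²)^α dA(z)` on the disc. -/
def weightedArea (α : ℝ) : Measure Disc :=
  discArea.withDensity fun z => ENNReal.ofReal ((1 - ‖(z : ℂ)‖ ^ 2) ^ α)

/-- The measure `(1/π) (1 - |z|²)^α dA(z)` on the disc. -/
def bergmanMeasure (α : ℝ) : Measure Disc :=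
  ENNReal.ofReal (1 / Real.pi) • weightedArea α

theorem Disc.one_sub_norm_sq_pos (z : Disc) : 0 < 1 - ‖(z : ℂ)‖ ^ 2 := by
  have h : ‖(z : ℂ)‖ < 1 := mem_ball_zero_iff.mp z.2
  nlinarith [norm_nonneg (z : ℂ)]

instance bergmanMeasure_isOpenPosMeasure (α : ℝ) : (bergmanMeasure α).IsOpenPosMeasure := by
  have hvol : discArea.IsOpenPosMeasure := by
    refine ⟨fun U hU hne h0 => ?_⟩
    rw [discArea,
      (MeasurableEmbedding.subtype_coe Metric.isOpen_ball.measurableSet).comap_apply] at h0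
    exact ((Metric.isOpen_ball.isOpenMap_subtype_val U hU).measure_pos volume
      (hne.image _)).ne' h0
  have h1 : discArea ≪ weightedArea α := by
    refine withDensity_absolutelyContinuous' ?_ ?_
    · refine Measurable.aemeasurable ?_
      fun_prop
    · refine Eventually.of_forall fun z => ?_
      exact (ENNReal.ofReal_pos.mpr (Real.rpow_pos_of_pos z.one_sub_norm_sq_pos α)).ne'
  have h2 : weightedArea α ≪ bergmanMeasure α := by
    refine Measure.absolutelyContinuous_smul ?_
    exact (ENNReal.ofReal_pos.mpr (by positivity)).ne'
  exact (h1.trans h2).isOpenPosMeasure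

/-- The vector space of holomorphic `f` with `(1/π) ∫ |f(z)|² (1 - |z|²)^α dA(z) < ∞`. -/
def bergmanSubmodule (α : ℝ) : Submodule ℂ (Disc → ℂ) where
  carrier := {f | IsHolomorphicOnDisc f ∧ MemLp f 2 (bergmanMeasure α)}
  zero_mem' := ⟨⟨0, differentiableOn_const _, fun _ => rfl⟩, MemLp.zero⟩
  add_mem' := by
    rintro f g ⟨⟨F, hF, hFf⟩, hf⟩ ⟨⟨G, hG, hGg⟩, hg⟩
    exact ⟨⟨F + G, hF.add hG, fun z => by simp [hFf, hGg]⟩, hf.add hg⟩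
  smul_mem' := by
    rintro c f ⟨⟨F, hF, hFf⟩, hf⟩
    exact ⟨⟨c • F, hF.const_smul c, fun z => by simp [hFf]⟩, hf.const_smul c⟩

/-- The weighted Bergman space `A²_α` (a separate type, so that its topology is the one of the
norm below, and not that of pointwise convergence). -/
def BergmanSpace (α : ℝ) : Type := bergmanSubmodule α

namespace BergmanSpace

variable {α : ℝ}

instance : AddCommGroup (BergmanSpace α) := inferInstanceAs (AddCommGroup (bergmanSubmodule α))

instance : Module ℂ (BergmanSpace α) := inferInstanceAs (Module ℂ (bergmanSubmodule α))

instance : CoeFun (BergmanSpace α) (fun _ => Disc → ℂ) := ⟨Subtype.val⟩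

theorem isHolomorphicOnDisc (f : BergmanSpace α) : IsHolomorphicOnDisc f := f.2.1

theorem memLp (f : BergmanSpace α) : MemLp f 2 (bergmanMeasure α) := f.2.2

/-- The inclusion of `A²_α` into `L²((1/π) (1 - |z|²)^α dA)`. -/
def toLp (α : ℝ) : BergmanSpace α →ₗ[ℂ] Lp ℂ 2 (bergmanMeasure α) where
  toFun f := f.memLp.toLp f
  map_add' _ _ := rfl
  map_smul' _ _ := rfl

theorem toLp_injective (α : ℝ) : Function.Injective (toLp α) := by
  intro f g h
  have h' : (f : Disc → ℂ) =ᵐ[bergmanMeasure α] g :=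
    (MemLp.toLp_eq_toLp_iff f.memLp g.memLp).mp h
  exact Subtype.ext ((f.isHolomorphicOnDisc.continuous.ae_eq_iff_eq _
    g.isHolomorphicOnDisc.continuous).mp h')

/-- The norm `‖f‖ = ((1/π) ∫ |f(z)|² (1 - |z|²)^α dA(z))^(1/2)`. -/
instance : NormedAddCommGroup (BergmanSpace α) :=
  NormedAddCommGroup.induced (BergmanSpace α) (Lp ℂ 2 (bergmanMeasure α)) (toLp α)
    (toLp_injective α)

instance : NormedSpace ℂ (BergmanSpace α) :=
  NormedSpace.induced ℂ (BergmanSpace α) (Lp ℂ 2 (bergmanMeasure α)) (toLp α)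

end BergmanSpace

/-- The weighted composition operator `f ↦ h · (f ∘ φ)` on functions. -/
def weightedComp (h : Disc → ℂ) (φ : Disc → Disc) (f : Disc → ℂ) : Disc → ℂ :=
  fun z => h z * f (φ z)

/-- `W_{h,φ}` maps `A²_α` into itself, as a bounded operator. -/
def IsBoundedWeightedComp (α : ℝ) (h : Disc → ℂ) (φ : Disc → Disc) : Prop :=
  ∃ T : BergmanSpace α →L[ℂ] BergmanSpace α,
    ∀ f : BergmanSpace α, (T f : Disc → ℂ) = weightedComp h φ f

/-- `W_{h,φ}` maps `A²_α` into itself, as a compact operator. -/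
def IsCompactWeightedComp (α : ℝ) (h : Disc → ℂ) (φ : Disc → Disc) : Prop :=
  ∃ T : BergmanSpace α →L[ℂ] BergmanSpace α, IsCompactOperator T ∧
    ∀ f : BergmanSpace α, (T f : Disc → ℂ) = weightedComp h φ f

/-- The measure `ν_{h,φ}(E) = ∫_{φ⁻¹(E)} |h(z)|² (1 - |z|²)^α dA(z)` on the disc. -/
def pullbackMeasure (α : ℝ) (h : Disc → ℂ) (φ : Disc → Disc) : Measure Disc :=
  ((weightedArea α).withDensity fun z => ‖h z‖ₑ ^ 2).map φ

/-- `μ` is an `A²_α`-Carleson measure: the canonical embedding `A²_α → L²(μ)` is bounded. -/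
def IsCarleson (α : ℝ) (μ : Measure Disc) : Prop :=
  ∃ J : BergmanSpace α →L[ℂ] Lp ℂ 2 μ, ∀ f : BergmanSpace α, (J f : Disc → ℂ) =ᵐ[μ] f

/-- `μ` is a vanishing `A²_α`-Carleson measure: the canonical embedding `A²_α → L²(μ)` is
compact. -/
def IsVanishingCarleson (α : ℝ) (μ : Measure Disc) : Prop :=
  ∃ J : BergmanSpace α →L[ℂ] Lp ℂ 2 μ, IsCompactOperator J ∧
    ∀ f : BergmanSpace α, (J f : Disc → ℂ) =ᵐ[μ] f

/-- The `A²_α`-norm, in `[0, ∞]`, of `(1 - |w|²)^(1 + α/2) h / (1 - w̄ φ)^(α + 2)`. The power is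
the principal one; note that `1 - w̄ φ(z)` has positive real part. -/
def kernelNorm (α : ℝ) (h : Disc → ℂ) (φ : Disc → Disc) (w : Disc) : ℝ≥0∞ :=
  eLpNorm (fun z : Disc => (((1 - ‖(w : ℂ)‖ ^ 2) ^ (1 + α / 2) : ℝ) : ℂ) * h z /
    (1 - conj (w : ℂ) * (φ z : ℂ)) ^ ((α : ℂ) + 2)) 2 (bergmanMeasure α)

end

/-! Everything rests on one pointwise estimate. Put k(u,z) = (1-|u|²)^(α+2) / |1-ūz|^(2α+4), which
is `kernelWeight α u z`, and dA_α = (1-|z|²)^α dA. The mean value property of (f ∘ `mobius z`)² on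
the disc of radius 1/2, transported back by the automorphism, gives |f(z)|² ≤ C ∫ |f(u)|² k(u,z)
dA_α(u) with C independent of f and z (`exists_sq_enorm_le_lintegral_kernelWeight`). Integrating in
z against μ and applying Tonelli bounds ∫ |f|² dμ by C ∫ |f(u)|² (∫ k(u,z) dμ(z)) dA_α(u).

Since k(u,·) is the squared modulus of the test function at u, for μ = ν_{h,φ} the inner integral is
π times the squared `kernelNorm` at u. A finite supremum therefore gives the Carleson inequality.
The converse holds because all the test functions have the same norm (`lintegral_kernelWeight`). The
change of variables ∫ |f|² dν = π ‖W f‖² makes boundedness of W and of the embedding the same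
inequality; it also makes their norms proportional, so compactness passes from one to the other.

If W is compact, the images of the test functions lie in a compact set and tend to 0 pointwise,
hence in norm. If `kernelNorm` tends to 0 at the boundary, split the integral over u at |u| = r:
beyond r the kernel norm is small, and on |u| ≤ r a finite net for uniform convergence (Cauchy
estimates and Arzelà–Ascoli) makes f - g small. Hence the image of the unit ball is totally bounded.
-/

/-! ### The involutive automorphisms of the disc -/

/-- The automorphism of the disc that interchanges `0` and `z`. -/
noncomputable def mobius (z v : ℂ) : ℂ := (z - v) / (1 - conj z * v)

theorem one_sub_conj_mul_ne_zero {z v : ℂ} (hz : ‖z‖ < 1) (hv : ‖v‖ < 1) :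
    1 - conj z * v ≠ 0 := by
  intro h
  have h1 : ‖conj z * v‖ = 1 := by rw [← sub_eq_zero.mp h, norm_one]
  rw [norm_mul, RCLike.norm_conj] at h1
  nlinarith [norm_nonneg z, norm_nonneg v]

theorem norm_one_sub_conj_mul_pos {z v : ℂ} (hz : ‖z‖ < 1) (hv : ‖v‖ < 1) :
    0 < ‖1 - conj z * v‖ :=
  norm_pos_iff.mpr (one_sub_conj_mul_ne_zero hz hv)

theorem norm_one_sub_conj_mul_comm (z v : ℂ) : ‖1 - conj z * v‖ = ‖1 - conj v * z‖ := by
  rw [← RCLike.norm_conj (1 - conj z * v)]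
  simp [mul_comm]

theorem one_sub_norm_sq_mobius {z v : ℂ} (hz : ‖z‖ < 1) (hv : ‖v‖ < 1) :
    1 - ‖mobius z v‖ ^ 2 = (1 - ‖z‖ ^ 2) * (1 - ‖v‖ ^ 2) / ‖1 - conj z * v‖ ^ 2 := by
  have h := (norm_one_sub_conj_mul_pos hz hv).ne'
  rw [mobius, norm_div, div_pow, eq_div_iff (pow_ne_zero 2 h), sub_mul,
    div_mul_cancel₀ _ (pow_ne_zero 2 h)]
  simp only [← Complex.normSq_eq_norm_sq, Complex.normSq_apply, Complex.sub_re, Complex.sub_im,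
    Complex.mul_re, Complex.mul_im, Complex.one_re, Complex.one_im, Complex.conj_re,
    Complex.conj_im]
  ring

theorem norm_mobius_lt_one {z v : ℂ} (hz : ‖z‖ < 1) (hv : ‖v‖ < 1) : ‖mobius z v‖ < 1 := by
  have h1 : 0 < 1 - ‖mobius z v‖ ^ 2 := by
    rw [one_sub_norm_sq_mobius hz hv]
    have := norm_one_sub_conj_mul_pos hz hv
    have h2 : 0 < 1 - ‖z‖ ^ 2 := by nlinarith [norm_nonneg z]
    have h3 : 0 < 1 - ‖v‖ ^ 2 := by nlinarith [norm_nonneg v]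
    positivity
  nlinarith [norm_nonneg (mobius z v)]

theorem ofReal_one_sub_norm_sq (z : ℂ) : ((1 - ‖z‖ ^ 2 : ℝ) : ℂ) = 1 - conj z * z := by
  rw [Complex.conj_mul']
  push_cast
  rfl

theorem one_sub_conj_mul_mobius {z v : ℂ} (hz : ‖z‖ < 1) (hv : ‖v‖ < 1) :
    1 - conj z * mobius z v = ((1 - ‖z‖ ^ 2 : ℝ) : ℂ) / (1 - conj z * v) := by
  have h := one_sub_conj_mul_ne_zero hz hv
  rw [ofReal_one_sub_norm_sq, mobius]
  field_simp
  ring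

theorem mobius_mobius {z v : ℂ} (hz : ‖z‖ < 1) (hv : ‖v‖ < 1) : mobius z (mobius z v) = v := by
  have h := one_sub_conj_mul_ne_zero hz hv
  have h2 := one_sub_conj_mul_ne_zero hz hz
  rw [mobius, one_sub_conj_mul_mobius hz hv, ofReal_one_sub_norm_sq, mobius,
    div_eq_iff (div_ne_zero h2 h), ← mul_div_assoc, eq_div_iff h, sub_mul, div_mul_cancel₀ _ h]
  ring

theorem hasDerivAt_mobius {z v : ℂ} (hz : ‖z‖ < 1) (hv : ‖v‖ < 1) :
    HasDerivAt (mobius z) (-((1 - ‖z‖ ^ 2 : ℝ) : ℂ) / (1 - conj z * v) ^ 2) v := by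
  have h1 : HasDerivAt (fun v : ℂ => z - v) (-1) v := (hasDerivAt_id v).const_sub z
  have h2 : HasDerivAt (fun v : ℂ => 1 - conj z * v) (-(conj z * 1)) v :=
    ((hasDerivAt_id v).const_mul _).const_sub 1
  refine (h1.div h2 (one_sub_conj_mul_ne_zero hz hv)).congr_deriv ?_
  rw [ofReal_one_sub_norm_sq]
  ring

theorem norm_lt_one (z : Disc) : ‖(z : ℂ)‖ < 1 := mem_ball_zero_iff.mp z.2

/-- `mobius` as a self-map of the disc. -/
noncomputable def discMobius (z v : Disc) : Disc :=
  ⟨mobius z v, mem_ball_zero_iff.mpr (norm_mobius_lt_one (norm_lt_one z) (norm_lt_one v))⟩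

theorem coe_discMobius (z v : Disc) : (discMobius z v : ℂ) = mobius z v := rfl

theorem lintegral_discArea (g : ℂ → ℝ≥0∞) :
    ∫⁻ z : Disc, g z ∂discArea = ∫⁻ z in Metric.ball (0 : ℂ) 1, g z :=
  lintegral_subtype_comap Metric.isOpen_ball.measurableSet g

/-- The real Jacobian of a holomorphic map is the squared modulus of its derivative. -/
theorem det_restrictScalars_toSpanSingleton (a : ℂ) :
    ((ContinuousLinearMap.toSpanSingleton ℂ a).restrictScalars ℝ).det = ‖a‖ ^ 2 := by
  have h : ((ContinuousLinearMap.toSpanSingleton ℂ a : ℂ →L[ℂ] ℂ) : ℂ →ₗ[ℂ] ℂ)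
      = a • LinearMap.id := by
    ext; simp
  rw [ContinuousLinearMap.det, ContinuousLinearMap.coe_restrictScalars,
    LinearMap.det_restrictScalars, h, LinearMap.det_smul]
  simp [Algebra.norm_complex_eq, Complex.normSq_eq_norm_sq]

theorem lintegral_comp_mobius (z : ℂ) (hz : ‖z‖ < 1) (g : ℂ → ℝ≥0∞) :
    ∫⁻ u in Metric.ball (0 : ℂ) 1, g u = ∫⁻ v in Metric.ball (0 : ℂ) 1,
      ENNReal.ofReal (((1 - ‖z‖ ^ 2) / ‖1 - conj z * v‖ ^ 2) ^ 2) * g (mobius z v) := by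
  have himage : mobius z '' Metric.ball (0 : ℂ) 1 = Metric.ball (0 : ℂ) 1 := by
    ext u
    simp only [Set.mem_image, mem_ball_zero_iff]
    constructor
    · rintro ⟨v, hv, rfl⟩
      exact norm_mobius_lt_one hz hv
    · exact fun hu => ⟨mobius z u, norm_mobius_lt_one hz hu, mobius_mobius hz hu⟩
  have hinj : Set.InjOn (mobius z) (Metric.ball (0 : ℂ) 1) := fun u hu v hv huv => by
    rw [← mobius_mobius hz (mem_ball_zero_iff.mp hu), huv,
      mobius_mobius hz (mem_ball_zero_iff.mp hv)]
  have key := lintegral_image_eq_lintegral_abs_det_fderiv_mul volume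
    Metric.isOpen_ball.measurableSet (fun v hv => ((hasDerivAt_mobius hz
      (mem_ball_zero_iff.mp hv)).hasFDerivAt.restrictScalars ℝ).hasFDerivWithinAt) hinj g
  rw [himage] at key
  rw [key]
  refine lintegral_congr fun v => ?_
  rw [det_restrictScalars_toSpanSingleton, abs_of_nonneg (sq_nonneg _), norm_div, norm_neg,
    Complex.norm_real, norm_pow, Real.norm_eq_abs, div_pow, div_pow, sq_abs]

theorem lintegral_comp_discMobius (z : Disc) (g : Disc → ℝ≥0∞) :
    ∫⁻ u, g u ∂discArea = ∫⁻ v : Disc, ENNReal.ofReal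
      (((1 - ‖(z : ℂ)‖ ^ 2) / ‖1 - conj (z : ℂ) * v‖ ^ 2) ^ 2) * g (discMobius z v)
        ∂discArea := by
  classical
  -- The value 0 off the disc is arbitrary: both integrals only see the disc.
  let G : ℂ → ℝ≥0∞ := fun u => if hu : u ∈ Metric.ball (0 : ℂ) 1 then g ⟨u, hu⟩ else 0
  have hG : ∀ u : Disc, G u = g u := fun u => by simp only [G, dif_pos u.2]
  have h := lintegral_comp_mobius z (norm_lt_one z) G
  rw [← lintegral_discArea, ← lintegral_discArea] at h
  simp only [← coe_discMobius, hG] at h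
  exact h

/-! ### Integrals over the disc -/

/-- The integrand may blow up at 1, but it is the nonnegative derivative of -(1-y²)^(α+1), which is
continuous up to 1 because α + 1 > 0. -/
theorem integrableOn_one_sub_sq_rpow_mul {α : ℝ} (hα : -1 < α) :
    IntegrableOn (fun y : ℝ => 2 * (α + 1) * y * (1 - y ^ 2) ^ α) (Set.Ioc 0 1) := by
  refine intervalIntegral.integrableOn_deriv_of_nonneg (g := fun y => -(1 - y ^ 2) ^ (α + 1))
    ?_ ?_ ?_
  · refine ContinuousOn.neg (ContinuousOn.rpow_const (by fun_prop) fun x _ => Or.inr (by linarith))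
  · intro x hx
    have h0 : 0 < 1 - x ^ 2 := by nlinarith [hx.1, hx.2]
    have h1 : HasDerivAt (fun y : ℝ => 1 - y ^ 2) (-(2 * x)) x := by
      simpa using (hasDerivAt_pow 2 x).const_sub 1
    refine (h1.rpow_const (p := α + 1) (Or.inl h0.ne')).neg.congr_deriv ?_
    rw [add_sub_cancel_right]
    ring
  · intro x hx
    have h0 : 0 < 1 - x ^ 2 := by nlinarith [hx.1, hx.2]
    have : 0 < α + 1 := by linarith
    have := hx.1
    positivity

theorem lintegral_one_sub_norm_sq_rpow_lt_top {α : ℝ} (hα : -1 < α) :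
    ∫⁻ z : Disc, ENNReal.ofReal ((1 - ‖(z : ℂ)‖ ^ 2) ^ α) ∂discArea < ⊤ := by
  rw [lintegral_discArea fun z => ENNReal.ofReal ((1 - ‖z‖ ^ 2) ^ α)]
  -- The polar coordinate formula concerns radial functions on all of ℂ, hence the cut-off at radius
  -- 1.
  let f : ℝ → ℝ := (Set.Iio 1).indicator fun y => (1 - y ^ 2) ^ α
  have hf : Integrable (fun z : ℂ => f ‖z‖) := by
    rw [integrable_fun_norm_addHaar volume (f := f)]
    have h1 : IntegrableOn (fun y : ℝ => y * (1 - y ^ 2) ^ α) (Set.Iio 1 ∩ Set.Ioi 0) := by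
      have h2 := ((integrableOn_one_sub_sq_rpow_mul hα).mono_set (s := Set.Iio 1 ∩ Set.Ioi 0)
        fun y hy => ⟨hy.2, le_of_lt hy.1⟩).const_mul (2 * (α + 1))⁻¹
      refine h2.congr (Eventually.of_forall fun y => ?_)
      have : α + 1 ≠ 0 := by linarith
      field_simp
    rw [← integrableOn_indicator_iff measurableSet_Iio] at h1
    refine h1.congr (Eventually.of_forall fun y => ?_)
    simp only [f, Set.indicator_apply, Complex.finrank_real_complex, smul_eq_mul]
    split_ifs <;> simp
  have h1 := (hf.integrableOn (s := Metric.ball (0 : ℂ) 1)).lintegral_lt_top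
  refine lt_of_eq_of_lt ?_ h1
  refine setLIntegral_congr_fun Metric.isOpen_ball.measurableSet fun z hz => ?_
  have hz' : ‖z‖ < 1 := mem_ball_zero_iff.mp hz
  simp [f, hz']

/-! ### Mean value inequalities -/

/-- Mean value property of the holomorphic function t ↦ g(tv)² on the unit circle. Fixing v and
rotating lets the area version follow from rotation invariance. -/
theorem sq_enorm_zero_le_lintegral_circle {g : ℂ → ℂ}
    (hg : DifferentiableOn ℂ g (Metric.ball 0 1)) {v : ℂ} (hv : ‖v‖ < 1) :
    ENNReal.ofReal (2 * Real.pi) * ‖g 0‖ₑ ^ 2 ≤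
      ∫⁻ θ in Set.Ioc 0 (2 * Real.pi), ‖g (circleMap 0 1 θ * v)‖ₑ ^ 2 := by
  have hd : DiffContOnCl ℂ (fun t => g (t * v) ^ 2) (Metric.ball 0 |1|) := by
    have : DifferentiableOn ℂ (fun t => g (t * v) ^ 2) (Metric.closedBall 0 |1|) := by
      refine (hg.comp (by fun_prop) fun t ht => ?_).pow 2
      rw [abs_one, mem_closedBall_zero_iff] at ht
      rw [mem_ball_zero_iff, norm_mul]
      nlinarith [norm_nonneg v]
    exact this.diffContOnCl_ball subset_rfl
  have h := hd.circleAverage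
  rw [Real.circleAverage_def, inv_smul_eq_iff₀ (by positivity), zero_mul] at h
  have hpi : (0 : ℝ) ≤ 2 * Real.pi := by positivity
  calc ENNReal.ofReal (2 * Real.pi) * ‖g 0‖ₑ ^ 2 = ‖(2 * Real.pi) • g 0 ^ 2‖ₑ := by
        rw [enorm_smul, enorm_pow, Real.enorm_of_nonneg hpi]
    _ = ‖∫ θ in Set.Ioc 0 (2 * Real.pi), g (circleMap 0 1 θ * v) ^ 2‖ₑ := by
        rw [← h, intervalIntegral.integral_of_le hpi]
    _ ≤ ∫⁻ θ in Set.Ioc 0 (2 * Real.pi), ‖g (circleMap 0 1 θ * v) ^ 2‖ₑ :=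
        enorm_integral_le_lintegral_enorm _
    _ = _ := by simp only [enorm_pow]

theorem lintegral_ball_circleMap_mul {F : ℂ → ℝ≥0∞} (R θ : ℝ) :
    ∫⁻ v in Metric.ball (0 : ℂ) R, F (circleMap 0 1 θ * v) = ∫⁻ v in Metric.ball (0 : ℂ) R, F v := by
  let e : ℂ ≃ₗᵢ[ℝ] ℂ := rotation ⟨circleMap 0 1 θ, by simp [Submonoid.unitSphere]⟩
  have he : ∀ v, e v = circleMap 0 1 θ * v := fun v => rfl
  have h := e.measurePreserving.setLIntegral_comp_preimage_emb
    e.toHomeomorph.measurableEmbedding F (Metric.ball 0 R)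
  have hpre : e ⁻¹' Metric.ball 0 R = Metric.ball 0 R := by
    rw [e.preimage_ball, map_zero]
  rw [hpre] at h
  simpa only [he] using h

theorem sq_enorm_zero_mul_volume_le {g : ℂ → ℂ} (hg : DifferentiableOn ℂ g (Metric.ball 0 1))
    {R : ℝ} (hR : R ≤ 1) :
    ‖g 0‖ₑ ^ 2 * volume (Metric.ball (0 : ℂ) R) ≤ ∫⁻ v in Metric.ball (0 : ℂ) R, ‖g v‖ₑ ^ 2 := by
  -- Nothing is known about g outside the unit disc; the indicator supplies the global measurability
  -- that Tonelli needs.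
  let F : ℂ → ℝ≥0∞ := (Metric.ball (0 : ℂ) 1).indicator fun v => ‖g v‖ₑ ^ 2
  have hsub : Metric.ball (0 : ℂ) R ⊆ Metric.ball 0 1 := Metric.ball_subset_ball hR
  have hF : Measurable F := by
    classical
    simp only [F, ← Set.piecewise_eq_indicator]
    exact ContinuousOn.measurable_piecewise (by have := hg.continuousOn; fun_prop)
      continuousOn_const Metric.isOpen_ball.measurableSet
  have hpi : ENNReal.ofReal (2 * Real.pi) ≠ 0 := (ENNReal.ofReal_pos.mpr (by positivity)).ne'
  rw [← ENNReal.mul_le_mul_iff_right hpi ENNReal.ofReal_ne_top, ← mul_assoc,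
    ← setLIntegral_const]
  calc ∫⁻ _ in Metric.ball (0 : ℂ) R, ENNReal.ofReal (2 * Real.pi) * ‖g 0‖ₑ ^ 2
      ≤ ∫⁻ v in Metric.ball (0 : ℂ) R, ∫⁻ θ in Set.Ioc 0 (2 * Real.pi),
          F (circleMap 0 1 θ * v) := by
        refine setLIntegral_mono' Metric.isOpen_ball.measurableSet fun v hv => ?_
        have hv' := mem_ball_zero_iff.mp (hsub hv)
        refine (sq_enorm_zero_le_lintegral_circle hg hv').trans (le_of_eq ?_)
        refine lintegral_congr fun θ => ?_
        have hmem : circleMap 0 1 θ * v ∈ Metric.ball (0 : ℂ) 1 := by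
          rw [mem_ball_zero_iff, norm_mul, norm_circleMap_zero]
          simpa using hv'
        exact (Set.indicator_of_mem hmem fun v => ‖g v‖ₑ ^ 2).symm
    _ = ∫⁻ θ in Set.Ioc 0 (2 * Real.pi), ∫⁻ v in Metric.ball (0 : ℂ) R,
          F (circleMap 0 1 θ * v) := by
        refine lintegral_lintegral_swap (Measurable.aemeasurable ?_)
        exact hF.comp (((continuous_circleMap 0 1).comp continuous_snd).mul
          continuous_fst).measurable
    _ = ∫⁻ _ in Set.Ioc 0 (2 * Real.pi), ∫⁻ v in Metric.ball (0 : ℂ) R, F v := by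
        simp only [lintegral_ball_circleMap_mul]
    _ = ENNReal.ofReal (2 * Real.pi) * ∫⁻ v in Metric.ball (0 : ℂ) R, F v := by
        rw [setLIntegral_const, Real.volume_Ioc, sub_zero, mul_comm]
    _ = _ := by
        congr 1
        refine setLIntegral_congr_fun Metric.isOpen_ball.measurableSet fun v hv => ?_
        exact Set.indicator_of_mem (hsub hv) fun v => ‖g v‖ₑ ^ 2

/-! ### The kernel -/

theorem lintegral_weightedArea (α : ℝ) (f : Disc → ℝ≥0∞) :
    ∫⁻ z, f z ∂weightedArea α =
      ∫⁻ z : Disc, ENNReal.ofReal ((1 - ‖(z : ℂ)‖ ^ 2) ^ α) * f z ∂discArea :=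
  lintegral_withDensity_eq_lintegral_mul_non_measurable _ (by fun_prop)
    (Eventually.of_forall fun _ => ENNReal.ofReal_lt_top) _

/-- The squared modulus of the normalised reproducing kernel at `w`, up to a constant. -/
noncomputable def kernelWeight (α : ℝ) (w z : Disc) : ℝ :=
  (1 - ‖(w : ℂ)‖ ^ 2) ^ (α + 2) / ‖1 - conj (w : ℂ) * z‖ ^ (2 * α + 4)

theorem kernelWeight_nonneg (α : ℝ) (w z : Disc) : 0 ≤ kernelWeight α w z := by
  have := w.one_sub_norm_sq_pos
  unfold kernelWeight
  positivity

theorem measurable_kernelWeight (α : ℝ) :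
    Measurable fun p : Disc × Disc => kernelWeight α p.2 p.1 := by
  unfold kernelWeight
  fun_prop

theorem norm_one_sub_conj_mul_discMobius (w v : Disc) :
    ‖1 - conj (w : ℂ) * discMobius w v‖ =
      (1 - ‖(w : ℂ)‖ ^ 2) / ‖1 - conj (w : ℂ) * v‖ := by
  rw [coe_discMobius, one_sub_conj_mul_mobius (norm_lt_one w) (norm_lt_one v), norm_div,
    Complex.norm_real, Real.norm_of_nonneg w.one_sub_norm_sq_pos.le]

theorem one_sub_norm_sq_discMobius (w v : Disc) :
    1 - ‖(discMobius w v : ℂ)‖ ^ 2 =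
      (1 - ‖(w : ℂ)‖ ^ 2) * (1 - ‖(v : ℂ)‖ ^ 2) / ‖1 - conj (w : ℂ) * v‖ ^ 2 :=
  one_sub_norm_sq_mobius (norm_lt_one w) (norm_lt_one v)

theorem rpow_two_mul_add_four {x : ℝ} (hx : 0 < x) (α : ℝ) :
    x ^ (2 * α + 4) = (x ^ α) ^ 2 * x ^ 4 := by
  rw [Real.rpow_add hx, two_mul, Real.rpow_add hx, ← sq]
  norm_cast

theorem rpow_two_mul_add_two {x : ℝ} (hx : 0 < x) (α : ℝ) :
    x ^ (2 * α + 2) = (x ^ α) ^ 2 * x ^ 2 := by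
  rw [Real.rpow_add hx, two_mul, Real.rpow_add hx, ← sq]
  norm_cast

theorem rpow_add_two {x : ℝ} (hx : 0 < x) (α : ℝ) : x ^ (α + 2) = x ^ α * x ^ 2 := by
  rw [Real.rpow_add hx]
  norm_cast

theorem sq_rpow_eq {x : ℝ} (hx : 0 < x) (α : ℝ) : (x ^ 2) ^ α = (x ^ α) ^ 2 := by
  rw [sq, Real.mul_rpow hx.le hx.le, sq]

/-- Under z = `mobius w v` the Jacobian, the weight and the kernel combine so that all powers of
1-|w|² and |1-w̄v| cancel. Thus the test functions share one norm. -/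
theorem lintegral_kernelWeight (α : ℝ) (w : Disc) :
    ∫⁻ z, ENNReal.ofReal (kernelWeight α w z) ∂weightedArea α =
      ∫⁻ z : Disc, ENNReal.ofReal ((1 - ‖(z : ℂ)‖ ^ 2) ^ α) ∂discArea := by
  rw [lintegral_weightedArea, lintegral_comp_discMobius w]
  refine lintegral_congr fun v => ?_
  have ha := w.one_sub_norm_sq_pos
  have hb := v.one_sub_norm_sq_pos
  have hd := norm_one_sub_conj_mul_pos (norm_lt_one w) (norm_lt_one v)
  rw [kernelWeight, norm_one_sub_conj_mul_discMobius, one_sub_norm_sq_discMobius]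
  set a := 1 - ‖(w : ℂ)‖ ^ 2
  set b := 1 - ‖(v : ℂ)‖ ^ 2
  set d := ‖1 - conj (w : ℂ) * v‖
  rw [← ENNReal.ofReal_mul (by positivity), ← ENNReal.ofReal_mul (by positivity)]
  congr 1
  have h1 : 0 < a ^ α := by positivity
  have h2 : 0 < b ^ α := by positivity
  have h3 : 0 < d ^ α := by positivity
  rw [rpow_add_two ha, rpow_two_mul_add_four (by positivity), Real.div_rpow (by positivity)
    (by positivity), Real.mul_rpow ha.le hb.le, sq_rpow_eq hd, Real.div_rpow ha.le hd.le]
  field_simp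

/-- Here the substitution is in the parameter of the kernel. The powers of 1-|z|² cancel, so the
right side is bounded below on |v| < 1/2 uniformly in z. -/
theorem kernelWeight_discMobius (α : ℝ) (z v : Disc) :
    ((1 - ‖(z : ℂ)‖ ^ 2) / ‖1 - conj (z : ℂ) * v‖ ^ 2) ^ 2 *
      ((1 - ‖(discMobius z v : ℂ)‖ ^ 2) ^ α * kernelWeight α (discMobius z v) z) =
    (1 - ‖(v : ℂ)‖ ^ 2) ^ (2 * α + 2) / ‖1 - conj (z : ℂ) * v‖ ^ (2 * α + 4) := by
  have ha := z.one_sub_norm_sq_pos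
  have hb := v.one_sub_norm_sq_pos
  have hd := norm_one_sub_conj_mul_pos (norm_lt_one z) (norm_lt_one v)
  rw [kernelWeight, norm_one_sub_conj_mul_comm (discMobius z v), norm_one_sub_conj_mul_discMobius,
    one_sub_norm_sq_discMobius]
  set a := 1 - ‖(z : ℂ)‖ ^ 2
  set b := 1 - ‖(v : ℂ)‖ ^ 2
  set d := ‖1 - conj (z : ℂ) * v‖
  have h1 : 0 < a ^ α := by positivity
  have h2 : 0 < b ^ α := by positivity
  have h3 : 0 < d ^ α := by positivity
  rw [rpow_add_two (by positivity), rpow_two_mul_add_four (by positivity),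
    rpow_two_mul_add_four hd, rpow_two_mul_add_two hb, Real.div_rpow (by positivity)
    (by positivity), Real.mul_rpow ha.le hb.le, sq_rpow_eq hd, Real.div_rpow ha.le hd.le]
  field_simp

theorem exists_sq_enorm_le_lintegral_kernelWeight {α : ℝ} (hα : -1 < α) :
    ∃ C : ℝ≥0∞, C ≠ ⊤ ∧ ∀ f : Disc → ℂ, IsHolomorphicOnDisc f → ∀ z : Disc,
      ‖f z‖ₑ ^ 2 ≤
        C * ∫⁻ u, ‖f u‖ₑ ^ 2 * ENNReal.ofReal (kernelWeight α u z) ∂weightedArea α := by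
  -- Lower bound of the transported kernel on |v| < 1/2, where 1-|v|² ≥ 3/4 and |1-z̄v| ≤ 2; both
  -- exponents are positive as α > -1.
  let c : ℝ := (3 / 4) ^ (2 * α + 2) / 2 ^ (2 * α + 4)
  have hc : 0 < c := by positivity
  let V : ℝ≥0∞ := volume (Metric.ball (0 : ℂ) (1 / 2))
  have hV : V ≠ 0 := (Metric.measure_ball_pos _ _ (by norm_num)).ne'
  have hV' : V ≠ ⊤ := measure_ball_lt_top.ne
  have hc0 : ENNReal.ofReal c ≠ 0 := (ENNReal.ofReal_pos.mpr hc).ne'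
  have hcV : ENNReal.ofReal c * V ≠ 0 := mul_ne_zero hc0 hV
  refine ⟨(ENNReal.ofReal c * V)⁻¹, ENNReal.inv_ne_top.mpr hcV, fun f ⟨F, hF, hFf⟩ z => ?_⟩
  rw [← ENNReal.mul_le_mul_iff_right hcV (ENNReal.mul_ne_top ENNReal.ofReal_ne_top hV'),
    ← mul_assoc, ENNReal.mul_inv_cancel hcV (ENNReal.mul_ne_top ENNReal.ofReal_ne_top hV'),
    one_mul]
  have hz := norm_lt_one z
  have hg : DifferentiableOn ℂ (fun v => F (mobius z v)) (Metric.ball 0 1) := by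
    refine hF.comp (fun v hv => ?_) fun v hv => ?_
    · exact (hasDerivAt_mobius hz
        (mem_ball_zero_iff.mp hv)).differentiableAt.differentiableWithinAt
    · exact mem_ball_zero_iff.mpr (norm_mobius_lt_one hz (mem_ball_zero_iff.mp hv))
  have hsub : Metric.ball (0 : ℂ) (1 / 2) ⊆ Metric.ball 0 1 :=
    Metric.ball_subset_ball (by norm_num)
  have h0 : F (mobius z 0) = f z := by rw [← hFf]; simp [mobius]
  have hmean := sq_enorm_zero_mul_volume_le hg (R := 1 / 2) (by norm_num)
  rw [h0] at hmean
  calc ENNReal.ofReal c * V * ‖f z‖ₑ ^ 2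
      ≤ ENNReal.ofReal c * ∫⁻ v in Metric.ball (0 : ℂ) (1 / 2), ‖F (mobius z v)‖ₑ ^ 2 := by
        rw [mul_assoc, mul_comm V]
        gcongr
    _ = ∫⁻ v in Metric.ball (0 : ℂ) (1 / 2), ENNReal.ofReal c * ‖F (mobius z v)‖ₑ ^ 2 :=
        (lintegral_const_mul' _ _ ENNReal.ofReal_ne_top).symm
    _ ≤ ∫⁻ v in Metric.ball (0 : ℂ) (1 / 2), ENNReal.ofReal ((1 - ‖v‖ ^ 2) ^ (2 * α + 2) /
          ‖1 - conj (z : ℂ) * v‖ ^ (2 * α + 4)) * ‖F (mobius z v)‖ₑ ^ 2 := by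
        refine setLIntegral_mono' Metric.isOpen_ball.measurableSet fun v hv => ?_
        have hv1 := mem_ball_zero_iff.mp (hsub hv)
        have hv2 := mem_ball_zero_iff.mp hv
        have hd := norm_one_sub_conj_mul_pos hz hv1
        have hd2 : ‖1 - conj (z : ℂ) * v‖ ≤ 2 := by
          refine (norm_sub_le _ _).trans ?_
          rw [norm_one, norm_mul, RCLike.norm_conj]
          nlinarith [norm_nonneg v, norm_nonneg (z : ℂ)]
        have hv3 : 3 / 4 ≤ 1 - ‖v‖ ^ 2 := by nlinarith [norm_nonneg v]
        refine mul_le_mul_left (ENNReal.ofReal_le_ofReal ?_) _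
        simp only [c]
        gcongr
        · linarith
        · linarith
    _ ≤ ∫⁻ v in Metric.ball (0 : ℂ) 1, ENNReal.ofReal ((1 - ‖v‖ ^ 2) ^ (2 * α + 2) /
          ‖1 - conj (z : ℂ) * v‖ ^ (2 * α + 4)) * ‖F (mobius z v)‖ₑ ^ 2 :=
        lintegral_mono_set hsub
    _ = ∫⁻ u, ‖f u‖ₑ ^ 2 * ENNReal.ofReal (kernelWeight α u z) ∂weightedArea α := by
        rw [lintegral_weightedArea, lintegral_comp_discMobius z, ← lintegral_discArea]
        refine lintegral_congr fun v => ?_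
        have hm := (discMobius z v).one_sub_norm_sq_pos
        rw [← kernelWeight_discMobius, ENNReal.ofReal_mul (by positivity),
          ENNReal.ofReal_mul (by positivity), ← coe_discMobius, hFf]
        ring

/-! ### The Bergman space -/

theorem isFiniteMeasure_weightedArea {α : ℝ} (hα : -1 < α) :
    IsFiniteMeasure (weightedArea α) := by
  refine ⟨?_⟩
  rw [weightedArea, withDensity_apply _ MeasurableSet.univ, Measure.restrict_univ]
  exact lintegral_one_sub_norm_sq_rpow_lt_top hα

theorem exists_lintegral_sq_enorm_le {α : ℝ} (hα : -1 < α) :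
    ∃ C : ℝ≥0∞, C ≠ ⊤ ∧ ∀ f : Disc → ℂ, IsHolomorphicOnDisc f → ∀ (μ : Measure Disc) [SFinite μ],
      ∫⁻ z, ‖f z‖ₑ ^ 2 ∂μ ≤ C * ∫⁻ u, ‖f u‖ₑ ^ 2 *
        ∫⁻ z, ENNReal.ofReal (kernelWeight α u z) ∂μ ∂weightedArea α := by
  obtain ⟨C, hC, h⟩ := exists_sq_enorm_le_lintegral_kernelWeight hα
  have := isFiniteMeasure_weightedArea hα
  refine ⟨C, hC, fun f hf μ _ => ?_⟩
  have hfm := hf.continuous.measurable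
  have hint : Measurable fun p : Disc × Disc =>
      ‖f p.2‖ₑ ^ 2 * ENNReal.ofReal (kernelWeight α p.2 p.1) := by
    have h1 : Measurable fun p : Disc × Disc => ENNReal.ofReal (kernelWeight α p.2 p.1) :=
      (measurable_kernelWeight α).ennreal_ofReal
    have h2 : Measurable fun p : Disc × Disc => f p.2 := hfm.comp measurable_snd
    exact (h2.enorm.pow_const 2).mul h1
  calc ∫⁻ z, ‖f z‖ₑ ^ 2 ∂μ
      ≤ ∫⁻ z, C * ∫⁻ u, ‖f u‖ₑ ^ 2 * ENNReal.ofReal (kernelWeight α u z) ∂weightedArea α ∂μ :=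
        lintegral_mono fun z => h f hf z
    _ = C * ∫⁻ z, ∫⁻ u, ‖f u‖ₑ ^ 2 * ENNReal.ofReal (kernelWeight α u z)
          ∂weightedArea α ∂μ := lintegral_const_mul' _ _ hC
    _ = C * ∫⁻ u, ∫⁻ z, ‖f u‖ₑ ^ 2 * ENNReal.ofReal (kernelWeight α u z)
          ∂μ ∂weightedArea α := by
        congr 1
        exact lintegral_lintegral_swap hint.aemeasurable
    _ = _ := by
        congr 1
        refine lintegral_congr fun u => ?_
        exact lintegral_const_mul' _ _ (by finiteness)

theorem eLpNorm_two_sq {X E : Type*} [MeasurableSpace X] [NormedAddCommGroup E] (μ : Measure X)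
    (f : X → E) : eLpNorm f 2 μ ^ 2 = ∫⁻ x, ‖f x‖ₑ ^ 2 ∂μ := by
  have h := eLpNorm_nnreal_pow_eq_lintegral (μ := μ) (f := f) (p := 2) two_ne_zero
  simpa using h

theorem eLpNorm_bergmanMeasure_sq (α : ℝ) (f : Disc → ℂ) :
    eLpNorm f 2 (bergmanMeasure α) ^ 2 =
      ENNReal.ofReal (1 / Real.pi) * ∫⁻ z, ‖f z‖ₑ ^ 2 ∂weightedArea α := by
  rw [eLpNorm_two_sq, bergmanMeasure, lintegral_smul_measure, smul_eq_mul]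

theorem ofReal_pi_mul_ofReal_one_div_pi :
    ENNReal.ofReal Real.pi * ENNReal.ofReal (1 / Real.pi) = 1 := by
  rw [← ENNReal.ofReal_mul Real.pi_pos.le, mul_one_div_cancel Real.pi_ne_zero, ENNReal.ofReal_one]

theorem lintegral_weightedArea_sq_enorm (α : ℝ) (f : Disc → ℂ) :
    ∫⁻ z, ‖f z‖ₑ ^ 2 ∂weightedArea α =
      ENNReal.ofReal Real.pi * eLpNorm f 2 (bergmanMeasure α) ^ 2 := by
  rw [eLpNorm_bergmanMeasure_sq, ← mul_assoc, ofReal_pi_mul_ofReal_one_div_pi, one_mul]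

namespace BergmanSpace

variable {α : ℝ}

theorem enorm_def (f : BergmanSpace α) : ‖f‖ₑ = eLpNorm f 2 (bergmanMeasure α) :=
  Lp.enorm_toLp f.memLp

theorem norm_toLp (f : BergmanSpace α) : ‖toLp α f‖ = ‖f‖ := rfl

theorem sub_apply (f g : BergmanSpace α) (z : Disc) :
    (f - g : BergmanSpace α) z = f z - g z := rfl

end BergmanSpace

theorem norm_le_sqrt_mul_of_sq_enorm_le {E F : Type*} [SeminormedAddCommGroup E]
    [SeminormedAddCommGroup F] {a : E} {b : F} {K : ℝ≥0∞} (hK : K ≠ ⊤)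
    (h : ‖a‖ₑ ^ 2 ≤ K * ‖b‖ₑ ^ 2) : ‖a‖ ≤ √K.toReal * ‖b‖ := by
  have h1 := ENNReal.toReal_mono (by finiteness) h
  simp only [ENNReal.toReal_mul, ENNReal.toReal_pow, toReal_enorm] at h1
  rw [← Real.sqrt_sq (norm_nonneg b), ← Real.sqrt_mul ENNReal.toReal_nonneg]
  exact Real.le_sqrt_of_sq_le h1

/-- From |1-ūz| ≥ 1-|u||z|. Bounding the product allows either variable to be the one kept away from
the boundary. -/
theorem kernelWeight_le_div {α : ℝ} (hα : -1 < α) {r : ℝ} (hr : r < 1) (u z : Disc)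
    (huz : ‖(u : ℂ)‖ * ‖(z : ℂ)‖ ≤ r) :
    kernelWeight α u z ≤ (1 - ‖(u : ℂ)‖ ^ 2) ^ (α + 2) / (1 - r) ^ (2 * α + 4) := by
  have hu := u.one_sub_norm_sq_pos
  have hr' : 0 < 1 - r := by linarith
  have h1 : 1 - r ≤ ‖1 - conj (u : ℂ) * z‖ := by
    have h2 := norm_sub_norm_le (1 : ℂ) (conj (u : ℂ) * z)
    rw [norm_one, norm_mul, RCLike.norm_conj] at h2
    linarith
  unfold kernelWeight
  gcongr
  linarith

theorem kernelWeight_le {α : ℝ} (hα : -1 < α) {r : ℝ} (hr : r < 1) (u z : Disc)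
    (huz : ‖(u : ℂ)‖ * ‖(z : ℂ)‖ ≤ r) : kernelWeight α u z ≤ 1 / (1 - r) ^ (2 * α + 4) := by
  have hu := u.one_sub_norm_sq_pos
  have hr' : 0 < 1 - r := by linarith
  refine (kernelWeight_le_div hα hr u z huz).trans ?_
  gcongr
  exact Real.rpow_le_one hu.le (by nlinarith [norm_nonneg (u : ℂ)]) (by linarith)

/-! ### Local bounds and completeness of the Bergman space -/

namespace BergmanSpace

variable {α : ℝ}

theorem exists_norm_apply_le (hα : -1 < α) {r : ℝ} (hr : r < 1) :
    ∃ C : ℝ, 0 ≤ C ∧ ∀ (f : BergmanSpace α) (z : Disc), ‖(z : ℂ)‖ ≤ r → ‖f z‖ ≤ C * ‖f‖ := by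
  obtain ⟨C, hC, h⟩ := exists_sq_enorm_le_lintegral_kernelWeight hα
  refine ⟨_, Real.sqrt_nonneg (C * (ENNReal.ofReal (1 / (1 - r) ^ (2 * α + 4)) *
    ENNReal.ofReal Real.pi)).toReal, fun f z hz => norm_le_sqrt_mul_of_sq_enorm_le
    (by finiteness) ?_⟩
  refine (h f f.isHolomorphicOnDisc z).trans ?_
  rw [enorm_def, mul_assoc, mul_assoc, ← lintegral_weightedArea_sq_enorm]
  gcongr
  rw [← lintegral_const_mul' _ _ ENNReal.ofReal_ne_top]
  refine lintegral_mono fun u => ?_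
  rw [mul_comm]
  gcongr
  refine kernelWeight_le hα hr u z ?_
  nlinarith [norm_lt_one u, norm_nonneg (z : ℂ)]

theorem exists_differentiableOn (f : ℕ → BergmanSpace α) : ∃ F : ℕ → ℂ → ℂ,
    (∀ n, DifferentiableOn ℂ (F n) (Metric.ball 0 1)) ∧ ∀ n (z : Disc), F n z = f n z := by
  choose F hF hFf using fun n => (f n).isHolomorphicOnDisc
  exact ⟨F, hF, hFf⟩

theorem exists_radius_of_isCompact {K : Set ℂ} (hK : IsCompact K)
    (hKs : K ⊆ Metric.ball 0 1) : ∃ r < 1, ∀ z ∈ K, ‖z‖ ≤ r := by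
  rcases K.eq_empty_or_nonempty with rfl | hne
  · exact ⟨0, by norm_num, by simp⟩
  · obtain ⟨x, hx, hmax⟩ := hK.exists_isMaxOn hne continuous_norm.continuousOn
    exact ⟨‖x‖, mem_ball_zero_iff.mp (hKs hx), fun z hz => hmax hz⟩

/-- Norm-Cauchy sequences converge locally uniformly, so the pointwise limit is holomorphic. It
agrees almost everywhere with the L² limit, since a subsequence converges to the latter almost
everywhere. -/
theorem completeSpace (hα : -1 < α) : CompleteSpace (BergmanSpace α) := by
  refine Metric.complete_of_cauchySeq_tendsto fun f hf => ?_
  have hcau : ∀ z : Disc, CauchySeq fun n => f n z := fun z => by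
    obtain ⟨C, hC, hCf⟩ := exists_norm_apply_le hα (norm_lt_one z)
    rw [Metric.cauchySeq_iff] at hf ⊢
    intro ε hε
    obtain ⟨N, hN⟩ := hf (ε / (C + 1)) (by positivity)
    refine ⟨N, fun m hm n hn => ?_⟩
    have h1 := hN m hm n hn
    rw [dist_eq_norm, lt_div_iff₀ (by positivity)] at h1
    rw [dist_eq_norm, ← sub_apply]
    refine (hCf _ z le_rfl).trans_lt ?_
    nlinarith [norm_nonneg (f m - f n)]
  choose g hg using fun z => cauchySeq_tendsto_of_complete (hcau z)
  obtain ⟨F, hF, hFf⟩ := exists_differentiableOn f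
  have hholo : IsHolomorphicOnDisc g := by
    classical
    let G : ℂ → ℂ := fun z => if hz : z ∈ Metric.ball (0 : ℂ) 1 then g ⟨z, hz⟩ else 0
    have hG : ∀ z : Disc, G z = g z := fun z => by simp only [G, dif_pos z.2]
    refine ⟨G, ?_, hG⟩
    refine TendstoLocallyUniformlyOn.differentiableOn (F := F) (φ := atTop) ?_
      (Eventually.of_forall hF) Metric.isOpen_ball
    rw [tendstoLocallyUniformlyOn_iff_forall_isCompact Metric.isOpen_ball]
    intro K hKs hK
    obtain ⟨r, hr, hrK⟩ := exists_radius_of_isCompact hK hKs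
    obtain ⟨C, hC, hCf⟩ := exists_norm_apply_le hα hr
    rw [Metric.tendstoUniformlyOn_iff]
    intro ε hε
    obtain ⟨N, hN⟩ := Metric.cauchySeq_iff.mp hf (ε / 2 / (C + 1)) (by positivity)
    filter_upwards [eventually_ge_atTop N] with n hn z hz
    have hlim : Tendsto (fun m => dist (f m ⟨z, hKs hz⟩) (f n ⟨z, hKs hz⟩)) atTop
        (𝓝 (dist (g ⟨z, hKs hz⟩) (f n ⟨z, hKs hz⟩))) := (hg _).dist tendsto_const_nhds
    have hle : dist (g ⟨z, hKs hz⟩) (f n ⟨z, hKs hz⟩) ≤ ε / 2 := by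
      refine le_of_tendsto hlim ?_
      filter_upwards [eventually_ge_atTop N] with m hm
      have h1 := hN m hm n hn
      rw [dist_eq_norm, lt_div_iff₀ (by positivity)] at h1
      rw [dist_eq_norm, ← sub_apply]
      refine (hCf _ ⟨z, hKs hz⟩ (hrK z hz)).trans ?_
      nlinarith [norm_nonneg (f m - f n)]
    have e1 := hG ⟨z, hKs hz⟩
    have e2 := hFf n ⟨z, hKs hz⟩
    rw [e1, e2]
    linarith
  have hcauLp : CauchySeq fun n => toLp α (f n) := by
    rw [Metric.cauchySeq_iff] at hf ⊢
    simpa only [dist_eq_norm, ← map_sub, norm_toLp] using hf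
  obtain ⟨G, hG⟩ := cauchySeq_tendsto_of_complete hcauLp
  have hGg : G =ᵐ[bergmanMeasure α] g := by
    obtain ⟨ns, hns, hae⟩ := (tendstoInMeasure_of_tendsto_Lp hG).exists_seq_tendsto_ae
    have hcoe : ∀ᵐ z ∂bergmanMeasure α, ∀ n, toLp α (f n) z = f n z :=
      ae_all_iff.mpr fun n => (f n).memLp.coeFn_toLp
    filter_upwards [hae, hcoe] with z hz hz2
    simp only [hz2] at hz
    exact tendsto_nhds_unique hz ((hg z).comp hns.tendsto_atTop)
  have hgm : MemLp g 2 (bergmanMeasure α) := (memLp_congr_ae hGg).mp (Lp.memLp G)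
  let g' : BergmanSpace α := ⟨g, hholo, hgm⟩
  have hg' : toLp α g' = G := by
    refine Lp.ext ?_
    exact (MemLp.coeFn_toLp hgm).trans hGg.symm
  refine ⟨g', ?_⟩
  rw [← hg', tendsto_iff_norm_sub_tendsto_zero] at hG
  rw [tendsto_iff_norm_sub_tendsto_zero]
  simpa only [← map_sub, norm_toLp] using hG

end BergmanSpace

/-! ### Compact operators through finite nets -/

section FiniteNets

variable {E F : Type*} [NormedAddCommGroup E] [NormedSpace ℂ E] [NormedAddCommGroup F]
  [NormedSpace ℂ F]

/-- The nets live in the domain, so only T applied to differences has to be estimated. -/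
theorem isCompactOperator_of_finite_nets [CompleteSpace F] (T : E →L[ℂ] F)
    (H : ∀ ε > 0, ∃ t : Set E, t.Finite ∧
      ∀ x ∈ Metric.closedBall (0 : E) 1, ∃ y ∈ t, ‖T (x - y)‖ < ε) :
    IsCompactOperator T := by
  refine (isCompactOperator_iff_isCompact_closure_image_closedBall (T : E →ₗ[ℂ] F)
    zero_lt_one).mpr ?_
  refine TotallyBounded.isCompact_of_isClosed (TotallyBounded.closure ?_) isClosed_closure
  rw [Metric.totallyBounded_iff]
  intro ε hε
  obtain ⟨t, ht, hxt⟩ := H ε hε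
  refine ⟨T '' t, ht.image T, ?_⟩
  rintro _ ⟨x, hx, rfl⟩
  obtain ⟨y, hy, hxy⟩ := hxt x hx
  rw [map_sub, ← dist_eq_norm] at hxy
  exact Set.mem_biUnion (Set.mem_image_of_mem T hy) hxy

theorem exists_finite_net_of_totallyBounded_image {X Y : Type*} [PseudoMetricSpace Y] {u : X → Y}
    {s : Set X} (h : TotallyBounded (u '' s)) {ε : ℝ} (hε : 0 < ε) :
    ∃ t ⊆ s, t.Finite ∧ ∀ x ∈ s, ∃ y ∈ t, dist (u x) (u y) < ε := by
  obtain ⟨t', ht's, ht'f, hcov⟩ := Metric.finite_approx_of_totallyBounded h ε hε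
  obtain ⟨t, hts, htf, rfl⟩ := Set.exists_subset_image_finite_and.mp ⟨t', ht's, ht'f, rfl⟩
  refine ⟨t, hts, htf, fun x hx => ?_⟩
  simpa using hcov (Set.mem_image_of_mem u hx)

/-- A net for the image of the unit ball under S, lifted to the ball, serves for T. This transfers
compactness between W and the embedding. -/
theorem IsCompactOperator.of_norm_le [CompleteSpace F] {G : Type*} [NormedAddCommGroup G]
    [NormedSpace ℂ G] {S : E →L[ℂ] G} (hS : IsCompactOperator S) (T : E →L[ℂ] F) {c : ℝ}
    (hc : 0 < c) (h : ∀ x, ‖T x‖ ≤ c * ‖S x‖) : IsCompactOperator T := by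
  refine isCompactOperator_of_finite_nets T fun ε hε => ?_
  have hcpt := (isCompactOperator_iff_isCompact_closure_image_closedBall (S : E →ₗ[ℂ] G)
    zero_lt_one).mp hS
  obtain ⟨t, -, htf, ht⟩ := exists_finite_net_of_totallyBounded_image
    (hcpt.totallyBounded.subset subset_closure) (div_pos hε hc)
  refine ⟨t, htf, fun x hx => ?_⟩
  obtain ⟨y, hy, hxy⟩ := ht x hx
  refine ⟨y, hy, (h _).trans_lt ?_⟩
  rw [map_sub, ← dist_eq_norm]
  rw [lt_div_iff₀ hc] at hxy
  rwa [mul_comm]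

end FiniteNets

/-! ### Uniform approximation on smaller discs -/

namespace BergmanSpace

variable {α : ℝ}

theorem exists_norm_apply_sub_apply_le (hα : -1 < α) {r : ℝ} (hr : r < 1) :
    ∃ L : ℝ, 0 ≤ L ∧ ∀ (f : BergmanSpace α) (z w : Disc), ‖(z : ℂ)‖ ≤ r → ‖(w : ℂ)‖ ≤ r →
      ‖f z - f w‖ ≤ L * ‖f‖ * ‖(z : ℂ) - w‖ := by
  -- Discs of radius (1-r)/2 about points of |z| ≤ r stay in |z| ≤ (1+r)/2, where f is bounded by
  -- C‖f‖; Cauchy's estimate bounds the derivative.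
  obtain ⟨C, hC, hCf⟩ := exists_norm_apply_le hα (r := (1 + r) / 2) (by linarith)
  have hd : 0 < (1 - r) / 2 := by linarith
  refine ⟨C / ((1 - r) / 2), by positivity, fun f z w hz hw => ?_⟩
  obtain ⟨F, hF, hFf⟩ := f.isHolomorphicOnDisc
  rw [← hFf, ← hFf]
  have hsub : ∀ x ∈ Metric.closedBall (0 : ℂ) r,
      Metric.closedBall x ((1 - r) / 2) ⊆ Metric.closedBall 0 ((1 + r) / 2) := fun x hx =>
    Metric.closedBall_subset_closedBall' (by rw [Metric.mem_closedBall] at hx; linarith)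
  have hsub1 : Metric.closedBall (0 : ℂ) ((1 + r) / 2) ⊆ Metric.ball 0 1 :=
    Metric.closedBall_subset_ball (by linarith)
  refine Convex.norm_image_sub_le_of_norm_deriv_le (s := Metric.closedBall (0 : ℂ) r)
    (fun x hx => ?_) (fun x hx => ?_) (convex_closedBall 0 r) (mem_closedBall_zero_iff.mpr hw)
    (mem_closedBall_zero_iff.mpr hz)
  · exact hF.differentiableAt (Metric.isOpen_ball.mem_nhds
      (hsub1 (hsub x hx (Metric.mem_closedBall_self hd.le))))
  · rw [div_mul_eq_mul_div]
    refine Complex.norm_deriv_le_of_forall_mem_sphere_norm_le hd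
      (hF.diffContOnCl_ball ((hsub x hx).trans hsub1)) fun y hy => ?_
    have hy' := hsub x hx (Metric.sphere_subset_closedBall hy)
    have e := hFf ⟨y, hsub1 hy'⟩
    rw [e]
    exact hCf f _ (mem_closedBall_zero_iff.mp hy')

/-- Montel's argument: the unit ball, restricted to |z| ≤ r, is uniformly bounded and
equi-Lipschitz, so Arzelà–Ascoli applies. -/
theorem exists_finite_net_uniform (hα : -1 < α) {r : ℝ} (hr : r < 1) {δ : ℝ} (hδ : 0 < δ) :
    ∃ t ⊆ Metric.closedBall (0 : BergmanSpace α) 1, t.Finite ∧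
      ∀ f ∈ Metric.closedBall (0 : BergmanSpace α) 1, ∃ g ∈ t,
        ∀ z : Disc, ‖(z : ℂ)‖ ≤ r → ‖(f - g) z‖ ≤ δ := by
  obtain ⟨C, hC, hCf⟩ := exists_norm_apply_le hα hr
  obtain ⟨L, hL, hLf⟩ := exists_norm_apply_sub_apply_le hα hr
  let ι : Metric.closedBall (0 : ℂ) r → Disc :=
    fun z => ⟨z, Metric.closedBall_subset_ball hr z.2⟩
  have hι : Continuous ι := by fun_prop
  have hιr : ∀ z, ‖(ι z : ℂ)‖ ≤ r := fun z => mem_closedBall_zero_iff.mp z.2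
  let Φ : BergmanSpace α → BoundedContinuousFunction (Metric.closedBall (0 : ℂ) r) ℂ := fun f =>
    BoundedContinuousFunction.mkOfCompact
      ⟨fun z => f (ι z), f.isHolomorphicOnDisc.continuous.comp hι⟩
  have hcpt : IsCompact (closure (Φ '' Metric.closedBall 0 1)) := by
    refine BoundedContinuousFunction.arzela_ascoli (Metric.closedBall 0 C)
      (isCompact_closedBall 0 C) _ ?_ ?_
    · rintro _ z ⟨f, hf, rfl⟩
      rw [mem_closedBall_zero_iff] at hf ⊢
      exact (hCf f _ (hιr z)).trans (by nlinarith)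
    · refine Metric.equicontinuous_of_continuity_modulus (fun d => L * d) ?_ _ ?_
      · exact (continuous_const_mul L).tendsto' 0 0 (mul_zero L)
      · rintro x y ⟨_, f, hf, rfl⟩
        rw [mem_closedBall_zero_iff] at hf
        rw [dist_eq_norm]
        refine (hLf f (ι x) (ι y) (hιr x) (hιr y)).trans ?_
        have : ‖(ι x : ℂ) - ι y‖ = dist x y := by rw [Subtype.dist_eq, dist_eq_norm]
        rw [this]
        have := dist_nonneg (x := x) (y := y)
        gcongr
        nlinarith
  obtain ⟨t, hts, htf, ht⟩ := exists_finite_net_of_totallyBounded_image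
    (hcpt.totallyBounded.subset subset_closure) hδ
  refine ⟨t, hts, htf, fun f hf => ?_⟩
  obtain ⟨g, hg, hfg⟩ := ht f hf
  refine ⟨g, hg, fun z hz => ?_⟩
  have h1 := (BoundedContinuousFunction.dist_coe_le_dist (f := Φ f) (g := Φ g)
    ⟨z, mem_closedBall_zero_iff.mpr hz⟩).trans hfg.le
  rwa [dist_eq_norm] at h1

end BergmanSpace

/-! ### Test functions -/

namespace BergmanSpace

variable {α : ℝ}

/-- The values of the normalised reproducing kernel at `w`, up to a constant. -/
noncomputable def testFun (α : ℝ) (w z : Disc) : ℂ :=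
  (((1 - ‖(w : ℂ)‖ ^ 2) ^ (1 + α / 2) : ℝ) : ℂ) / (1 - conj (w : ℂ) * z) ^ ((α : ℂ) + 2)

theorem sq_norm_testFun (α : ℝ) (w z : Disc) : ‖testFun α w z‖ ^ 2 = kernelWeight α w z := by
  have hw := w.one_sub_norm_sq_pos
  have e : ((α : ℂ) + 2) = ((α + 2 : ℝ) : ℂ) := by push_cast; rfl
  rw [testFun, kernelWeight, norm_div, e, Complex.norm_cpow_real, Complex.norm_real,
    Real.norm_of_nonneg (by positivity), div_pow, ← Real.rpow_mul_natCast hw.le,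
    ← Real.rpow_mul_natCast (norm_nonneg _)]
  push_cast
  congr 2 <;> ring

theorem sq_enorm_testFun (α : ℝ) (w z : Disc) :
    ‖testFun α w z‖ₑ ^ 2 = ENNReal.ofReal (kernelWeight α w z) := by
  rw [← sq_norm_testFun, ENNReal.ofReal_pow (norm_nonneg _), ofReal_norm]

theorem isHolomorphicOnDisc_testFun (α : ℝ) (w : Disc) : IsHolomorphicOnDisc (testFun α w) := by
  refine ⟨fun z => (((1 - ‖(w : ℂ)‖ ^ 2) ^ (1 + α / 2) : ℝ) : ℂ) /
    (1 - conj (w : ℂ) * z) ^ ((α : ℂ) + 2), ?_, fun _ => rfl⟩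
  have hslit : ∀ z ∈ Metric.ball (0 : ℂ) 1, 1 - conj (w : ℂ) * z ∈ Complex.slitPlane := by
    intro z hz
    refine Or.inl ?_
    have h1 : (conj (w : ℂ) * z).re ≤ ‖conj (w : ℂ) * z‖ := Complex.re_le_norm _
    rw [norm_mul, RCLike.norm_conj] at h1
    have h2 := mem_ball_zero_iff.mp hz
    rw [Complex.sub_re, Complex.one_re]
    nlinarith [norm_lt_one w, norm_nonneg (w : ℂ), norm_nonneg z]
  refine (differentiableOn_const _).div ?_ fun z hz => ?_
  · exact DifferentiableOn.cpow (by fun_prop) (differentiableOn_const _) hslit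
  · rw [Ne, Complex.cpow_eq_zero_iff]
    exact fun h => Complex.slitPlane_ne_zero (hslit z hz) h.1

theorem eLpNorm_testFun_sq (α : ℝ) (w : Disc) :
    eLpNorm (testFun α w) 2 (bergmanMeasure α) ^ 2 = ENNReal.ofReal (1 / Real.pi) *
      ∫⁻ z : Disc, ENNReal.ofReal ((1 - ‖(z : ℂ)‖ ^ 2) ^ α) ∂discArea := by
  rw [eLpNorm_bergmanMeasure_sq, ← lintegral_kernelWeight α w]
  simp only [sq_enorm_testFun]

/-- The normalised reproducing kernel at `w`, up to a constant. -/
noncomputable def test (hα : -1 < α) (w : Disc) : BergmanSpace α :=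
  ⟨testFun α w, isHolomorphicOnDisc_testFun α w,
    (isHolomorphicOnDisc_testFun α w).continuous.aestronglyMeasurable, by
      have h := lintegral_one_sub_norm_sq_rpow_lt_top hα
      have h2 : eLpNorm (testFun α w) 2 (bergmanMeasure α) ^ 2 < ⊤ := by
        rw [eLpNorm_testFun_sq]
        exact ENNReal.mul_lt_top ENNReal.ofReal_lt_top h
      simpa using h2⟩

theorem test_apply (hα : -1 < α) (w z : Disc) : test hα w z = testFun α w z := rfl

theorem sq_enorm_test (hα : -1 < α) (w : Disc) :
    ‖test hα w‖ₑ ^ 2 = ENNReal.ofReal (1 / Real.pi) *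
      ∫⁻ z : Disc, ENNReal.ofReal ((1 - ‖(z : ℂ)‖ ^ 2) ^ α) ∂discArea := by
  rw [enorm_def]
  exact eLpNorm_testFun_sq α w

theorem exists_norm_test_le (hα : -1 < α) : ∃ R : ℝ, ∀ w, ‖test hα w‖ ≤ R := by
  refine ⟨_, fun w => norm_le_sqrt_mul_of_sq_enorm_le (b := (1 : ℝ)) (K := ENNReal.ofReal
    (1 / Real.pi) * ∫⁻ z : Disc, ENNReal.ofReal ((1 - ‖(z : ℂ)‖ ^ 2) ^ α) ∂discArea)
    (ENNReal.mul_ne_top ENNReal.ofReal_ne_top (lintegral_one_sub_norm_sq_rpow_lt_top hα).ne) ?_⟩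
  rw [sq_enorm_test, enorm_one, one_pow, mul_one]

end BergmanSpace

theorem eventually_comap_norm_nhdsLT_one {p : Disc → Prop} :
    (∀ᶠ w in comap (fun w : Disc => ‖(w : ℂ)‖) (𝓝[<] 1), p w) ↔
      ∃ r : ℝ, r < 1 ∧ ∀ w : Disc, r < ‖(w : ℂ)‖ → p w := by
  rw [((nhdsLT_basis (1 : ℝ)).comap _).eventually_iff]
  refine exists_congr fun r => and_congr_right fun _ => ?_
  exact ⟨fun h w hw => h ⟨hw, norm_lt_one w⟩, fun h w hw => h w hw.1⟩

theorem tendsto_kernelWeight {α : ℝ} (hα : -1 < α) (z : Disc) :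
    Tendsto (fun w => kernelWeight α w z) (comap (fun w : Disc => ‖(w : ℂ)‖) (𝓝[<] 1)) (𝓝 0) := by
  have h1 : Tendsto (fun w : Disc => ‖(w : ℂ)‖) (comap (fun w : Disc => ‖(w : ℂ)‖) (𝓝[<] 1))
      (𝓝 1) := tendsto_comap.mono_right nhdsWithin_le_nhds
  have h2 : Tendsto (fun w : Disc => (1 - ‖(w : ℂ)‖ ^ 2) ^ (α + 2) /
      (1 - ‖(z : ℂ)‖) ^ (2 * α + 4)) (comap (fun w : Disc => ‖(w : ℂ)‖) (𝓝[<] 1)) (𝓝 0) := by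
    have h3 := (((h1.pow 2).const_sub 1).rpow_const (p := α + 2)
      (Or.inr (by linarith))).div_const ((1 - ‖(z : ℂ)‖) ^ (2 * α + 4))
    rwa [one_pow, sub_self, Real.zero_rpow (by linarith), zero_div] at h3
  refine squeeze_zero (fun w => kernelWeight_nonneg α w z) (fun w => ?_) h2
  refine kernelWeight_le_div hα (norm_lt_one z) w z ?_
  nlinarith [norm_lt_one w, norm_nonneg (z : ℂ)]

/-! ### Carleson measures and weighted composition operators -/

/-- The embedding inequality that characterises Carleson measures. -/
def CarlesonBound (α : ℝ) (μ : Measure Disc) : Prop :=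
  ∃ C : ℝ≥0∞, C ≠ ⊤ ∧ ∀ f : BergmanSpace α, ∫⁻ z, ‖f z‖ₑ ^ 2 ∂μ ≤ C * ‖f‖ₑ ^ 2

theorem sq_enorm_Lp {X : Type*} [MeasurableSpace X] {μ : Measure X} (g : Lp ℂ 2 μ) {f : X → ℂ}
    (h : g =ᵐ[μ] f) : ‖g‖ₑ ^ 2 = ∫⁻ x, ‖f x‖ₑ ^ 2 ∂μ := by
  rw [Lp.enorm_def, eLpNorm_congr_ae h, eLpNorm_two_sq]

theorem sq_enorm_apply_le {E F : Type*} [NormedAddCommGroup E] [NormedSpace ℂ E]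
    [NormedAddCommGroup F] [NormedSpace ℂ F] (T : E →L[ℂ] F) (x : E) :
    ‖T x‖ₑ ^ 2 ≤ ‖T‖ₑ ^ 2 * ‖x‖ₑ ^ 2 := by
  rw [← mul_pow]
  exact pow_le_pow_left' (T.le_opENorm x) 2

theorem isCarleson_iff {α : ℝ} {μ : Measure Disc} : IsCarleson α μ ↔ CarlesonBound α μ := by
  constructor
  · rintro ⟨J, hJ⟩
    refine ⟨‖J‖ₑ ^ 2, by finiteness, fun f => ?_⟩
    rw [← sq_enorm_Lp (J f) (hJ f)]
    exact sq_enorm_apply_le J f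
  · rintro ⟨C, hC, hf⟩
    have hmem : ∀ f : BergmanSpace α, MemLp f 2 μ := fun f => by
      refine ⟨f.isHolomorphicOnDisc.continuous.aestronglyMeasurable, ?_⟩
      have h2 : eLpNorm f 2 μ ^ 2 < ⊤ := by
        rw [eLpNorm_two_sq]
        exact (hf f).trans_lt (by finiteness)
      simpa using h2
    let J : BergmanSpace α →ₗ[ℂ] Lp ℂ 2 μ :=
      { toFun := fun f => (hmem f).toLp f
        map_add' := fun _ _ => rfl
        map_smul' := fun _ _ => rfl }
    have hJ : ∀ f, J f =ᵐ[μ] f := fun f => (hmem f).coeFn_toLp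
    refine ⟨J.mkContinuous (√C.toReal) fun f => norm_le_sqrt_mul_of_sq_enorm_le hC ?_, hJ⟩
    rw [sq_enorm_Lp (J f) (hJ f)]
    exact hf f

section WeightedComp

variable {α : ℝ} {φ : Disc → Disc} {h : BergmanSpace α}

theorem lintegral_pullbackMeasure (hφ : IsHolomorphicOnDisc fun z => (φ z : ℂ)) {g : Disc → ℝ≥0∞}
    (hg : Measurable g) :
    ∫⁻ z, g z ∂pullbackMeasure α h φ = ∫⁻ z, ‖h z‖ₑ ^ 2 * g (φ z) ∂weightedArea α := by
  have hφm : Measurable φ := (hφ.continuous.subtype_mk fun z => (φ z).2).measurable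
  have hhm : Measurable h := h.isHolomorphicOnDisc.continuous.measurable
  rw [pullbackMeasure, lintegral_map hg hφm]
  exact lintegral_withDensity_eq_lintegral_mul _ (hhm.enorm.pow_const 2) (hg.comp hφm)

theorem lintegral_pullbackMeasure_sq_enorm (hφ : IsHolomorphicOnDisc fun z => (φ z : ℂ))
    {f : Disc → ℂ} (hf : IsHolomorphicOnDisc f) :
    ∫⁻ z, ‖f z‖ₑ ^ 2 ∂pullbackMeasure α h φ =
      ENNReal.ofReal Real.pi * eLpNorm (weightedComp h φ f) 2 (bergmanMeasure α) ^ 2 := by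
  rw [lintegral_pullbackMeasure hφ (hf.continuous.measurable.enorm.pow_const 2),
    ← lintegral_weightedArea_sq_enorm]
  simp only [weightedComp, enorm_mul, mul_pow]

/-- The total mass is π‖h‖². Finiteness justifies Tonelli and bounds `kernelNorm` away from the
boundary. -/
theorem isFiniteMeasure_pullbackMeasure (hφ : IsHolomorphicOnDisc fun z => (φ z : ℂ)) :
    IsFiniteMeasure (pullbackMeasure α h φ) := by
  refine ⟨?_⟩
  have e := lintegral_pullbackMeasure (h := h) hφ (measurable_const (a := (1 : ℝ≥0∞)))
  simp only [lintegral_const, one_mul, mul_one] at e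
  rw [e, lintegral_weightedArea_sq_enorm]
  exact ENNReal.mul_lt_top ENNReal.ofReal_lt_top (ENNReal.pow_lt_top h.memLp.eLpNorm_lt_top)

theorem isHolomorphicOnDisc_weightedComp (hφ : IsHolomorphicOnDisc fun z => (φ z : ℂ))
    {g f : Disc → ℂ} (hg : IsHolomorphicOnDisc g) (hf : IsHolomorphicOnDisc f) :
    IsHolomorphicOnDisc (weightedComp g φ f) := by
  obtain ⟨Φ, hΦ, hΦφ⟩ := hφ
  obtain ⟨G, hG, hGg⟩ := hg
  obtain ⟨F, hF, hFf⟩ := hf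
  refine ⟨fun z => G z * F (Φ z), hG.mul (hF.comp hΦ fun z hz => ?_), fun z => ?_⟩
  · have e := hΦφ ⟨z, hz⟩
    rw [e]
    exact (φ _).2
  · have e : Φ z = φ z := hΦφ z
    change G z * F (Φ z) = g z * f (φ z)
    rw [hGg, e, hFf]

theorem lintegral_pullbackMeasure_eq (hφ : IsHolomorphicOnDisc fun z => (φ z : ℂ))
    {f g : BergmanSpace α} (hfg : (g : Disc → ℂ) = weightedComp h φ f) :
    ∫⁻ z, ‖f z‖ₑ ^ 2 ∂pullbackMeasure α h φ = ENNReal.ofReal Real.pi * ‖g‖ₑ ^ 2 := by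
  rw [lintegral_pullbackMeasure_sq_enorm hφ f.isHolomorphicOnDisc, ← hfg, BergmanSpace.enorm_def]

theorem isBoundedWeightedComp_iff (hφ : IsHolomorphicOnDisc fun z => (φ z : ℂ)) :
    IsBoundedWeightedComp α h φ ↔ CarlesonBound α (pullbackMeasure α h φ) := by
  constructor
  · rintro ⟨T, hT⟩
    refine ⟨ENNReal.ofReal Real.pi * ‖T‖ₑ ^ 2, by finiteness, fun f => ?_⟩
    rw [lintegral_pullbackMeasure_eq hφ (hT f), mul_assoc]
    gcongr
    exact sq_enorm_apply_le T f
  · rintro ⟨C, hC, hf⟩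
    have hle : ∀ f : BergmanSpace α, eLpNorm (weightedComp h φ f) 2 (bergmanMeasure α) ^ 2 ≤
        ENNReal.ofReal (1 / Real.pi) * C * ‖f‖ₑ ^ 2 := fun f => by
      have h1 := hf f
      rw [lintegral_pullbackMeasure_sq_enorm hφ f.isHolomorphicOnDisc] at h1
      have h2 := mul_le_mul_right h1 (ENNReal.ofReal (1 / Real.pi))
      rwa [← mul_assoc, mul_comm (ENNReal.ofReal (1 / Real.pi)),
        ofReal_pi_mul_ofReal_one_div_pi, one_mul, ← mul_assoc] at h2
    have hC' : ENNReal.ofReal (1 / Real.pi) * C ≠ ⊤ := by finiteness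
    have hmem : ∀ f : BergmanSpace α, weightedComp h φ f ∈ bergmanSubmodule α := fun f => by
      have hol := isHolomorphicOnDisc_weightedComp hφ h.isHolomorphicOnDisc f.isHolomorphicOnDisc
      refine ⟨hol, hol.continuous.aestronglyMeasurable, ?_⟩
      have h2 := (hle f).trans_lt (by finiteness)
      simpa using h2
    let T : BergmanSpace α →ₗ[ℂ] BergmanSpace α :=
      { toFun := fun f => ⟨weightedComp h φ f, hmem f⟩
        map_add' := fun f g => Subtype.ext (funext fun z => mul_add _ _ _)
        map_smul' := fun c f => Subtype.ext (funext fun z => mul_left_comm _ _ _) }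
    refine ⟨T.mkContinuous _ fun f => norm_le_sqrt_mul_of_sq_enorm_le hC' ?_, fun f => rfl⟩
    rw [BergmanSpace.enorm_def]
    exact hle f

theorem kernelNorm_eq (hα : -1 < α) (w : Disc) : kernelNorm α h φ w =
    eLpNorm (weightedComp h φ (BergmanSpace.test hα w)) 2 (bergmanMeasure α) := by
  unfold kernelNorm
  congr 1
  funext z
  rw [weightedComp, BergmanSpace.test_apply, BergmanSpace.testFun]
  ring

theorem lintegral_kernelWeight_pullbackMeasure (hα : -1 < α)
    (hφ : IsHolomorphicOnDisc fun z => (φ z : ℂ)) (w : Disc) :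
    ∫⁻ z, ENNReal.ofReal (kernelWeight α w z) ∂pullbackMeasure α h φ =
      ENNReal.ofReal Real.pi * kernelNorm α h φ w ^ 2 := by
  rw [kernelNorm_eq hα, ← lintegral_pullbackMeasure_sq_enorm hφ
    (BergmanSpace.test hα w).isHolomorphicOnDisc]
  simp only [BergmanSpace.test_apply, BergmanSpace.sq_enorm_testFun]

theorem exists_lintegral_pullbackMeasure_le (hα : -1 < α)
    (hφ : IsHolomorphicOnDisc fun z => (φ z : ℂ)) :
    ∃ C : ℝ≥0∞, C ≠ ⊤ ∧ ∀ f : BergmanSpace α, ∫⁻ z, ‖f z‖ₑ ^ 2 ∂pullbackMeasure α h φ ≤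
      C * ∫⁻ u, ‖f u‖ₑ ^ 2 * kernelNorm α h φ u ^ 2 ∂weightedArea α := by
  obtain ⟨C, hC, H⟩ := exists_lintegral_sq_enorm_le hα
  have := isFiniteMeasure_pullbackMeasure (h := h) hφ
  refine ⟨C * ENNReal.ofReal Real.pi, by finiteness, fun f => ?_⟩
  refine (H f f.isHolomorphicOnDisc (pullbackMeasure α h φ)).trans_eq ?_
  rw [mul_assoc, ← lintegral_const_mul' _ _ ENNReal.ofReal_ne_top]
  congr 1
  refine lintegral_congr fun u => ?_
  rw [lintegral_kernelWeight_pullbackMeasure hα hφ]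
  ring

theorem carlesonBound_pullbackMeasure_iff (hα : -1 < α)
    (hφ : IsHolomorphicOnDisc fun z => (φ z : ℂ)) :
    CarlesonBound α (pullbackMeasure α h φ) ↔ (⨆ w : Disc, kernelNorm α h φ w) < ⊤ := by
  constructor
  · intro hb
    obtain ⟨T, hT⟩ := (isBoundedWeightedComp_iff hφ).mpr hb
    obtain ⟨R, hR⟩ := BergmanSpace.exists_norm_test_le hα
    refine lt_of_le_of_lt (iSup_le fun w => ?_)
      (ENNReal.mul_lt_top (enorm_lt_top (x := T)) (ENNReal.ofReal_lt_top (r := R)))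
    rw [kernelNorm_eq hα, ← hT, ← BergmanSpace.enorm_def]
    refine (T.le_opENorm _).trans ?_
    gcongr
    rw [← ofReal_norm]
    exact ENNReal.ofReal_le_ofReal (hR w)
  · intro hsup
    obtain ⟨C, hC, H⟩ := exists_lintegral_pullbackMeasure_le (h := h) hα hφ
    set M := ⨆ w : Disc, kernelNorm α h φ w
    refine ⟨C * M ^ 2 * ENNReal.ofReal Real.pi, by finiteness, fun f => (H f).trans ?_⟩
    rw [mul_assoc, mul_assoc, BergmanSpace.enorm_def, ← lintegral_weightedArea_sq_enorm,
      ← lintegral_const_mul' (M ^ 2) _ (by finiteness)]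
    refine mul_le_mul_right (lintegral_mono fun u => ?_) C
    rw [mul_comm]
    refine mul_le_mul_left (pow_le_pow_left' ?_ 2) _
    exact le_iSup (kernelNorm α h φ) u

/-! ### Compactness -/

theorem isCompactWeightedComp_iff_isVanishingCarleson (hα : -1 < α)
    (hφ : IsHolomorphicOnDisc fun z => (φ z : ℂ)) :
    IsCompactWeightedComp α h φ ↔ IsVanishingCarleson α (pullbackMeasure α h φ) := by
  have := BergmanSpace.completeSpace hα
  have hsq : ∀ (T : BergmanSpace α →L[ℂ] BergmanSpace α)
      (J : BergmanSpace α →L[ℂ] Lp ℂ 2 (pullbackMeasure α h φ)),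
      (∀ f, (T f : Disc → ℂ) = weightedComp h φ f) → (∀ f, J f =ᵐ[pullbackMeasure α h φ] f) →
      ∀ f, ‖J f‖ₑ ^ 2 = ENNReal.ofReal Real.pi * ‖T f‖ₑ ^ 2 := fun T J hT hJ f => by
    rw [sq_enorm_Lp (J f) (hJ f), lintegral_pullbackMeasure_eq hφ (hT f)]
  constructor
  · rintro ⟨T, hTc, hT⟩
    obtain ⟨J, hJ⟩ := isCarleson_iff.mpr ((isBoundedWeightedComp_iff hφ).mp ⟨T, hT⟩)
    refine ⟨J, hTc.of_norm_le J (c := √(ENNReal.ofReal Real.pi).toReal) ?_ fun f =>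
      norm_le_sqrt_mul_of_sq_enorm_le ENNReal.ofReal_ne_top (hsq T J hT hJ f).le, hJ⟩
    rw [ENNReal.toReal_ofReal Real.pi_pos.le]
    exact Real.sqrt_pos.mpr Real.pi_pos
  · rintro ⟨J, hJc, hJ⟩
    obtain ⟨T, hT⟩ := (isBoundedWeightedComp_iff hφ).mpr (isCarleson_iff.mp ⟨J, hJ⟩)
    refine ⟨T, hJc.of_norm_le T (c := √(ENNReal.ofReal (1 / Real.pi)).toReal) ?_ fun f =>
      norm_le_sqrt_mul_of_sq_enorm_le ENNReal.ofReal_ne_top ?_, hT⟩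
    · rw [ENNReal.toReal_ofReal (by positivity)]
      exact Real.sqrt_pos.mpr (by positivity)
    · rw [hsq T J hT hJ, ← mul_assoc, mul_comm (ENNReal.ofReal (1 / Real.pi)),
        ofReal_pi_mul_ofReal_one_div_pi, one_mul]

theorem BergmanSpace.continuous_apply (hα : -1 < α) (z : Disc) :
    Continuous fun f : BergmanSpace α => f z := by
  obtain ⟨C, hC, hCf⟩ := exists_norm_apply_le hα (norm_lt_one z)
  refine LipschitzWith.continuous (K := ⟨C, hC⟩) (LipschitzWith.of_dist_le_mul fun f g => ?_)
  rw [dist_eq_norm, dist_eq_norm, ← sub_apply]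
  exact hCf _ z le_rfl

theorem BergmanSpace.tendsto_test_apply (hα : -1 < α) (z : Disc) :
    Tendsto (fun w => test hα w z) (comap (fun w : Disc => ‖(w : ℂ)‖) (𝓝[<] 1)) (𝓝 0) := by
  rw [tendsto_zero_iff_norm_tendsto_zero]
  have h1 := (tendsto_kernelWeight hα z).sqrt
  rw [Real.sqrt_zero] at h1
  refine h1.congr fun w => ?_
  rw [← sq_norm_testFun, Real.sqrt_sq (norm_nonneg _), test_apply]

theorem tendsto_kernelNorm_of_isCompactWeightedComp (hα : -1 < α)
    (hc : IsCompactWeightedComp α h φ) :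
    Tendsto (kernelNorm α h φ) (comap (fun w : Disc => ‖(w : ℂ)‖) (𝓝[<] 1)) (𝓝 0) := by
  obtain ⟨T, hTc, hT⟩ := hc
  obtain ⟨R, hR⟩ := BergmanSpace.exists_norm_test_le hα
  obtain ⟨K, hK, hTK⟩ := IsCompactOperator.image_closedBall_subset_compact
    (f := (T : BergmanSpace α →ₗ[ℂ] BergmanSpace α)) hTc R
  have hlim : Tendsto (fun w => T (BergmanSpace.test hα w))
      (comap (fun w : Disc => ‖(w : ℂ)‖) (𝓝[<] 1)) (𝓝 0) := by
    refine hK.tendsto_nhds_of_unique_mapClusterPt (Eventually.of_forall fun w => hTK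
      (Set.mem_image_of_mem _ (mem_closedBall_zero_iff.mpr (hR w)))) fun g _ hg => ?_
    -- A norm cluster point g is identified through its values: evaluation at z is continuous, and
    -- h(z) times the test function at φ(z) tends to 0.
    refine Subtype.ext (funext fun z => ?_)
    have h1 : MapClusterPt (g z) (comap (fun w : Disc => ‖(w : ℂ)‖) (𝓝[<] 1))
        (fun w => T (BergmanSpace.test hα w) z) :=
      hg.continuousAt_comp (BergmanSpace.continuous_apply hα z).continuousAt
    have h2 : Tendsto (fun w => T (BergmanSpace.test hα w) z)
        (comap (fun w : Disc => ‖(w : ℂ)‖) (𝓝[<] 1)) (𝓝 0) := by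
      have h3 := (BergmanSpace.tendsto_test_apply hα (φ z)).const_mul (h z)
      rw [mul_zero] at h3
      refine h3.congr fun w => ?_
      rw [hT]
      rfl
    have h4 : ClusterPt (g z) (𝓝 0) := ClusterPt.mono h1 h2
    exact eq_of_nhds_neBot h4
  have h5 := (continuous_enorm.tendsto _).comp hlim
  rw [enorm_zero] at h5
  refine h5.congr fun w => ?_
  rw [Function.comp_apply, BergmanSpace.enorm_def, hT, kernelNorm_eq hα]

theorem exists_kernelNorm_sq_le (hα : -1 < α) (hφ : IsHolomorphicOnDisc fun z => (φ z : ℂ))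
    {r : ℝ} (hr : r < 1) :
    ∃ M : ℝ≥0∞, M ≠ ⊤ ∧ ∀ w : Disc, ‖(w : ℂ)‖ ≤ r → kernelNorm α h φ w ^ 2 ≤ M := by
  have := isFiniteMeasure_pullbackMeasure (h := h) hφ
  refine ⟨ENNReal.ofReal (1 / Real.pi) * (ENNReal.ofReal (1 / (1 - r) ^ (2 * α + 4)) *
    pullbackMeasure α h φ Set.univ), by finiteness, fun w hw => ?_⟩
  have e : kernelNorm α h φ w ^ 2 = ENNReal.ofReal (1 / Real.pi) *
      ∫⁻ z, ENNReal.ofReal (kernelWeight α w z) ∂pullbackMeasure α h φ := by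
    rw [lintegral_kernelWeight_pullbackMeasure hα hφ, ← mul_assoc,
      mul_comm (ENNReal.ofReal (1 / Real.pi)), ofReal_pi_mul_ofReal_one_div_pi, one_mul]
  rw [e, ← lintegral_const]
  gcongr with z
  refine kernelWeight_le hα hr w z ?_
  nlinarith [norm_lt_one z, norm_nonneg (w : ℂ)]

theorem iSup_kernelNorm_lt_top_of_tendsto (hα : -1 < α)
    (hφ : IsHolomorphicOnDisc fun z => (φ z : ℂ))
    (hlim : Tendsto (kernelNorm α h φ) (comap (fun w : Disc => ‖(w : ℂ)‖) (𝓝[<] 1)) (𝓝 0)) :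
    (⨆ w : Disc, kernelNorm α h φ w) < ⊤ := by
  obtain ⟨r, hr, hr1⟩ := eventually_comap_norm_nhdsLT_one.mp
    (hlim.eventually (gt_mem_nhds zero_lt_one))
  obtain ⟨M, hM, hMw⟩ := exists_kernelNorm_sq_le (h := h) hα hφ hr
  -- M bounds the square of the kernel norm, which dominates the kernel norm itself once that is at
  -- least 1; otherwise 1 suffices.
  refine lt_of_le_of_lt (iSup_le fun w => ?_) (b := 1 + M) (by finiteness)
  rcases lt_or_ge r ‖(w : ℂ)‖ with hw | hw
  · exact (hr1 w hw).le.trans le_self_add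
  · rcases le_total (kernelNorm α h φ w) 1 with h1 | h1
    · exact h1.trans le_self_add
    · exact ((le_self_pow h1 two_ne_zero).trans (hMw w hw)).trans le_add_self

theorem isCompactWeightedComp_of_tendsto (hα : -1 < α)
    (hφ : IsHolomorphicOnDisc fun z => (φ z : ℂ))
    (hlim : Tendsto (kernelNorm α h φ) (comap (fun w : Disc => ‖(w : ℂ)‖) (𝓝[<] 1)) (𝓝 0)) :
    IsCompactWeightedComp α h φ := by
  have := BergmanSpace.completeSpace hα
  have := isFiniteMeasure_weightedArea hα
  have hsup := iSup_kernelNorm_lt_top_of_tendsto hα hφ hlim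
  obtain ⟨T, hT⟩ := (isBoundedWeightedComp_iff hφ).mpr
    ((carlesonBound_pullbackMeasure_iff hα hφ).mpr hsup)
  refine ⟨T, isCompactOperator_of_finite_nets T fun ε hε => ?_, hT⟩
  obtain ⟨C, hC, H⟩ := exists_lintegral_pullbackMeasure_le (h := h) hα hφ
  set M := ⨆ w : Disc, kernelNorm α h φ w
  set A := weightedArea α Set.univ
  have hA : A ≠ ⊤ := measure_ne_top _ _
  -- Chosen so that ‖T(f-g)‖² ≤ Kθ. The summand with 2² comes from |u| > r, using ‖f-g‖ ≤ 2; the one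
  -- with M²A comes from |u| ≤ r, using |f-g|² ≤ θ.
  let K : ℝ≥0∞ := ENNReal.ofReal (1 / Real.pi) *
    (C * (ENNReal.ofReal Real.pi * 2 ^ 2 + M ^ 2 * A))
  have hK : K ≠ ⊤ := by finiteness
  obtain ⟨θ, hθ0, hθ⟩ : ∃ θ : ℝ, 0 < θ ∧ K * ENNReal.ofReal θ < ENNReal.ofReal (ε ^ 2) := by
    refine ⟨ε ^ 2 / (K.toReal + 1), by positivity, ?_⟩
    rw [← ENNReal.ofReal_toReal hK, ← ENNReal.ofReal_mul ENNReal.toReal_nonneg,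
      ENNReal.toReal_ofReal ENNReal.toReal_nonneg]
    refine (ENNReal.ofReal_lt_ofReal_iff (by positivity)).mpr ?_
    rw [mul_div_assoc', div_lt_iff₀ (by positivity), mul_comm]
    have := sq_pos_of_pos hε
    nlinarith
  have hlim2 : Tendsto (fun w => kernelNorm α h φ w ^ 2)
      (comap (fun w : Disc => ‖(w : ℂ)‖) (𝓝[<] 1)) (𝓝 0) := by
    have h1 := ((ENNReal.continuous_pow 2).tendsto 0).comp hlim
    rwa [zero_pow two_ne_zero] at h1
  obtain ⟨r, hr, hrθ⟩ := eventually_comap_norm_nhdsLT_one.mp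
    (hlim2.eventually (gt_mem_nhds (ENNReal.ofReal_pos.mpr hθ0)))
  obtain ⟨t, ht, htf, hnet⟩ :=
    BergmanSpace.exists_finite_net_uniform hα hr (Real.sqrt_pos.mpr hθ0)
  refine ⟨t, htf, fun f hf => ?_⟩
  obtain ⟨g, hg, hfg⟩ := hnet f hf
  refine ⟨g, hg, ?_⟩
  have hnorm : ‖f - g‖ₑ ≤ 2 := by
    have h1 := mem_closedBall_zero_iff.mp hf
    have h2 := mem_closedBall_zero_iff.mp (ht hg)
    rw [← ofReal_norm]
    refine ENNReal.ofReal_le_of_le_toReal ?_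
    rw [ENNReal.toReal_ofNat]
    linarith [norm_sub_le f g]
  -- Each region needs only one summand; adding both gives a single bound on the whole disc, so the
  -- integral need not be split.
  have hpt : ∀ u, ‖(f - g) u‖ₑ ^ 2 * kernelNorm α h φ u ^ 2 ≤
      ENNReal.ofReal θ * ‖(f - g) u‖ₑ ^ 2 + M ^ 2 * ENNReal.ofReal θ := fun u => by
    rcases lt_or_ge r ‖(u : ℂ)‖ with hu | hu
    · refine le_trans ?_ le_self_add
      rw [mul_comm]
      exact mul_le_mul_left (hrθ u hu).le _
    · refine le_trans ?_ le_add_self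
      rw [mul_comm]
      refine mul_le_mul' (pow_le_pow_left' (le_iSup (kernelNorm α h φ) u) 2) ?_
      rw [← ofReal_norm, ← ENNReal.ofReal_pow (norm_nonneg _)]
      refine ENNReal.ofReal_le_ofReal ?_
      rw [← Real.sq_sqrt hθ0.le]
      exact pow_le_pow_left₀ (norm_nonneg _) (hfg u hu) 2
  have hint : ∫⁻ u, ‖(f - g) u‖ₑ ^ 2 * kernelNorm α h φ u ^ 2 ∂weightedArea α ≤
      (ENNReal.ofReal Real.pi * 2 ^ 2 + M ^ 2 * A) * ENNReal.ofReal θ := by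
    refine (lintegral_mono hpt).trans ?_
    rw [lintegral_add_right _ measurable_const, lintegral_const,
      lintegral_const_mul' _ _ ENNReal.ofReal_ne_top, lintegral_weightedArea_sq_enorm,
      ← BergmanSpace.enorm_def]
    calc ENNReal.ofReal θ * (ENNReal.ofReal Real.pi * ‖f - g‖ₑ ^ 2) +
          M ^ 2 * ENNReal.ofReal θ * A
        ≤ ENNReal.ofReal θ * (ENNReal.ofReal Real.pi * 2 ^ 2) + M ^ 2 * ENNReal.ofReal θ * A := by
          gcongr
      _ = _ := by ring
  have hsq : ‖T (f - g)‖ₑ ^ 2 < ENNReal.ofReal (ε ^ 2) := by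
    calc ‖T (f - g)‖ₑ ^ 2 = ENNReal.ofReal (1 / Real.pi) *
          ∫⁻ z, ‖(f - g) z‖ₑ ^ 2 ∂pullbackMeasure α h φ := by
          rw [lintegral_pullbackMeasure_eq hφ (hT (f - g)), ← mul_assoc,
            mul_comm (ENNReal.ofReal (1 / Real.pi)), ofReal_pi_mul_ofReal_one_div_pi, one_mul]
      _ ≤ ENNReal.ofReal (1 / Real.pi) * (C *
          ((ENNReal.ofReal Real.pi * 2 ^ 2 + M ^ 2 * A) * ENNReal.ofReal θ)) :=
          mul_le_mul_right ((H (f - g)).trans (mul_le_mul_right hint C)) _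
      _ = K * ENNReal.ofReal θ := by
          simp only [K]
          ring
      _ < _ := hθ
  rw [← ofReal_norm, ← ENNReal.ofReal_pow (norm_nonneg _),
    ENNReal.ofReal_lt_ofReal_iff (by positivity)] at hsq
  exact lt_of_pow_lt_pow_left₀ 2 hε.le hsq

end WeightedComp

theorem mainTheorem3 (α : ℝ) (hα : -1 < α) (φ : Disc → Disc)
    (hφ : IsHolomorphicOnDisc fun z => (φ z : ℂ)) (h : BergmanSpace α) :
    ((IsBoundedWeightedComp α h φ ↔ IsCarleson α (pullbackMeasure α h φ)) ∧
      (IsBoundedWeightedComp α h φ ↔ (⨆ w : Disc, kernelNorm α h φ w) < ⊤)) ∧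
    ((IsCompactWeightedComp α h φ ↔ IsVanishingCarleson α (pullbackMeasure α h φ)) ∧
      (IsCompactWeightedComp α h φ ↔
        Tendsto (kernelNorm α h φ) (comap (fun w : Disc => ‖(w : ℂ)‖) (𝓝[<] 1)) (𝓝 0))) :=
  ⟨⟨(isBoundedWeightedComp_iff hφ).trans isCarleson_iff.symm,
    (isBoundedWeightedComp_iff hφ).trans (carlesonBound_pullbackMeasure_iff hα hφ)⟩,
    isCompactWeightedComp_iff_isVanishingCarleson hα hφ,
    tendsto_kernelNorm_of_isCompactWeightedComp hα, isCompactWeightedComp_of_tendsto hα hφ⟩
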